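/- **Setting.** An instance $I=(U,W,(\succ_x)_{x\in U\cup W},q)$ of many-to-one matching consists of finite sets $U$ of students and $W$ of schools, a strict preference list $\succ_u$ over a non-empty set of acceptable schools for each student $u$, a strict priority order $\succ_w$ over a non-empty set of students for each school $w$ (where $w$ is acceptable to $u$ if and only if $u$ is in the priority order of $w$), and capacities $q(w)\ge 1$. Students prefer acceptable schools to being unmatched. A matching is a partial map $\mu:U\to W$ with $\mu(u)$ acceptable to $u$ whenever it is defined. It is perfect if every student is matched. It is stable if $|\mu^{-1}(w)|\le q(w)$ for all $w$ and there is no blocking pair, i.e. no mutually acceptable pair $(u,w)$ such that $u$ is unmatched or prefers $w$ to $\mu(u)$, and $w$ has fewer than $q(w)$ students or prefers $u$ to one of its students. It is a student-optimal stable matching if it is stable and every student weakly prefers it to every stable matching. For a vector $r\in\mathbb{Z}_{\ge 0}^{W}$ put $|r|_\infty=\max_w r(w)$ (and $0$ if $W=\emptyset$), and let $I+r$ be $I$ with capacities $q+r$. The vector $r$ is feasible if $I+r$ has a stable and perfect matching, and optimal if it is feasible and $|r|_\infty$ is minimum among all feasible vectors. The problem MinMaxSP asks, given $I$ and $k\in\mathbb{Z}_{\ge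 0}$, whether there is a feasible $r$ with $|r|_\infty\le k$. **Uniform-increment algorithm.** Start with $r=0$ and the student-optimal stable matching $\mu$ of $I$. While $\mu$ is not perfect, increase $r(w)$ by one for all $w\in W$ and let $\mu$ be the student-optimal stable matching of $I+r$. When $\mu$ is perfect, return $(r,\mu)$. **Theorem.** 1. MinMaxSP is decidable in polynomial time. 2. On every instance $I$ the uniform-increment algorithm terminates, and for every pair $(r,\mu)$ that it returns: $r$ is optimal; $\mu$ is perfect and is the student-optimal stable matching of $I+r$; and every student weakly prefers $\mu$ to every stable matching of $I+r'$, for every $r'\in\mathbb{Z}_{\ge 0}^{W}$ with $|r'|_\infty\le|r|_\infty$. 3. There is a polynomial-time algorithm that, given $I$, outputs the optimal value $k^{\max}=|r|_\infty$ together with the pair $(r,\mu)$ returned by the uniform-increment algorithm. Here polynomial time means time polynomial in the length of the input (lists and binary numbers) on a random-access machine with logarithmic cost, i.e. with each step charged one plus the binary lengths of the numbers that it handles. -/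

import Mathlib

/-! ### Many-to-one matching -/

namespace ManyToOne

/-- `a` comes strictly before `b` in the (strict, linear) preference list `l`. -/
def Precedes {k : ℕ} (l : List (Fin k)) (a b : Fin k) : Prop :=
  a ∈ l ∧ b ∈ l ∧ l.idxOf a < l.idxOf b

/-- An instance of the many-to-one matching problem with `n` students and `m` schools.
Preference lists and priority orders are duplicate-free lists, most preferred agent first; they are
non-empty, acceptability is mutual, and every capacity is at least one. -/
structure Market (n m : ℕ) where
  pref : Fin n → List (Fin m)
  prio : Fin m → List (Fin n)
  cap : Fin m → ℕ
  pref_nodup : ∀ u, (pref u).Nodup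
  prio_nodup : ∀ w, (prio w).Nodup
  pref_ne_nil : ∀ u, pref u ≠ []
  prio_ne_nil : ∀ w, prio w ≠ []
  mutual_acceptable : ∀ u w, w ∈ pref u ↔ u ∈ prio w
  cap_pos : ∀ w, 1 ≤ cap w

variable {n m : ℕ}

/-- The same instance with the capacity vector `q` replaced by `q + r`. -/
def Market.raise (I : Market n m) (r : Fin m → ℕ) : Market n m where
  pref := I.pref
  prio := I.prio
  cap := fun w => I.cap w + r w
  pref_nodup := I.pref_nodup
  prio_nodup := I.prio_nodup
  pref_ne_nil := I.pref_ne_nil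
  prio_ne_nil := I.prio_ne_nil
  mutual_acceptable := I.mutual_acceptable
  cap_pos := fun w => le_trans (I.cap_pos w) (Nat.le_add_right _ _)

/-- An assignment of the students; `none` means unmatched. -/
abbrev Assignment (n m : ℕ) := Fin n → Option (Fin m)

/-- Student `u` strictly prefers the outcome `a` to the outcome `b`; every acceptable school is
preferred to being unmatched. -/
def Market.Prefers (I : Market n m) (u : Fin n) : Option (Fin m) → Option (Fin m) → Prop
  | some w, some w' => Precedes (I.pref u) w w'
  | some w, none => w ∈ I.pref u
  | none, _ => False

def Market.WeaklyPrefers (I : Market n m) (u : Fin n) (a b : Option (Fin m)) : Prop :=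
  a = b ∨ I.Prefers u a b

/-- A matching assigns students to acceptable schools only. -/
def Market.IsMatching (I : Market n m) (μ : Assignment n m) : Prop :=
  ∀ u w, μ u = some w → w ∈ I.pref u

/-- The number of students assigned to school `w`. -/
def load (μ : Assignment n m) (w : Fin m) : ℕ :=
  (Finset.univ.filter fun u => μ u = some w).card

/-- No school receives more students than its capacity. -/
def Market.RespectsCap (I : Market n m) (μ : Assignment n m) : Prop :=
  ∀ w, load μ w ≤ I.cap w

/-- The student `u` and the school `w` block `μ`. -/
def Market.Blocks (I : Market n m) (μ : Assignment n m) (u : Fin n) (w : Fin m) : Prop :=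
  u ∈ I.prio w ∧ I.Prefers u (some w) (μ u) ∧
    (load μ w < I.cap w ∨ ∃ u', μ u' = some w ∧ Precedes (I.prio w) u u')

def Market.IsStable (I : Market n m) (μ : Assignment n m) : Prop :=
  I.IsMatching μ ∧ I.RespectsCap μ ∧ ∀ u w, ¬ I.Blocks μ u w

/-- Stable, and weakly preferred by every student to every stable matching. -/
def Market.IsStudentOptimal (I : Market n m) (μ : Assignment n m) : Prop :=
  I.IsStable μ ∧ ∀ σ, I.IsStable σ → ∀ u, I.WeaklyPrefers u (μ u) (σ u)

def IsPerfect (μ : Assignment n m) : Prop := ∀ u, μ u ≠ none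

/-! ### The problem MinMaxSP -/

/-- The maximum entry of a capacity increase vector. -/
def maxNorm (r : Fin m → ℕ) : ℕ := Finset.univ.sup r

/-- After increasing the capacities by `r` there is a stable and perfect matching. -/
def Market.Feasible (I : Market n m) (r : Fin m → ℕ) : Prop :=
  ∃ μ, (I.raise r).IsStable μ ∧ IsPerfect μ

/-- The decision problem: is there a feasible capacity increase vector with maximum entry at most
`k`? -/
def Market.MinMaxSP (I : Market n m) (k : ℕ) : Prop :=
  ∃ r : Fin m → ℕ, maxNorm r ≤ k ∧ I.Feasible r

/-- `r` is an optimal capacity increase vector. -/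
def Market.IsOptimal (I : Market n m) (r : Fin m → ℕ) : Prop :=
  I.Feasible r ∧ ∀ r', I.Feasible r' → maxNorm r ≤ maxNorm r'

/-- `r` is an optimal capacity increase vector, `μ` is the student-optimal stable matching for the
capacities `q + r`, it is perfect, and every student weakly prefers it to every matching
that is stable for some capacity increase vector with no larger maximum entry. -/
def Market.IsBestSolution (I : Market n m) (r : Fin m → ℕ) (μ : Assignment n m) : Prop :=
  I.IsOptimal r ∧ (I.raise r).IsStudentOptimal μ ∧ IsPerfect μ ∧
    ∀ r', maxNorm r' ≤ maxNorm r → ∀ σ, (I.raise r').IsStable σ →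
      ∀ u, I.WeaklyPrefers u (μ u) (σ u)

/-! ### The algorithm -/

/-- The pairs `(r, μ)` that hold at the test of the while loop of the algorithm that starts with
`r = 0` and, as long as the student-optimal stable matching `μ` for `q + r` leaves a student
unmatched, increases every entry of `r` by one and recomputes `μ`. -/
inductive UniformLoop (I : Market n m) : (Fin m → ℕ) → Assignment n m → Prop
  | start {μ} : (I.raise fun _ => 0).IsStudentOptimal μ → UniformLoop I (fun _ => 0) μ
  | next {r μ μ'} : UniformLoop I r μ → ¬ IsPerfect μ →
      (I.raise fun w => r w + 1).IsStudentOptimal μ' → UniformLoop I (fun w => r w + 1) μ'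

/-- The algorithm stops with the capacity increase vector `r` and returns `μ`. -/
def UniformReturns (I : Market n m) (r : Fin m → ℕ) (μ : Assignment n m) : Prop :=
  UniformLoop I r μ ∧ IsPerfect μ

/-! ### Encodings -/

/-- An instance with any numbers of students and schools. -/
structure Instance where
  n : ℕ
  m : ℕ
  market : Market n m

/-- A list of indices, preceded by its length. -/
def encodeList {k : ℕ} (l : List (Fin k)) : List ℕ :=
  l.length :: l.map fun i => (i : ℕ)

/-- The numbers of students and of schools, the capacities, all preference lists, all priority
orders. -/
def Instance.encode (I : Instance) : List ℕ :=
  I.n :: I.m :: (List.ofFn I.market.cap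
    ++ (List.ofFn fun u => encodeList (I.market.pref u)).flatten
    ++ (List.ofFn fun w => encodeList (I.market.prio w)).flatten)

/-- An instance of the decision problem: the bound, followed by the matching instance. -/
def encodeQuery (x : Instance × ℕ) : List ℕ := x.2 :: x.1.encode

/-- `0` for an unmatched student, `w + 1` for a student matched to school `w`. -/
def encodeOutcome : Option (Fin m) → ℕ
  | none => 0
  | some w => (w : ℕ) + 1

/-- The maximum entry of `r`, then the entries of `r`, then the outcomes of all students. -/
def encodeSolution (r : Fin m → ℕ) (μ : Assignment n m) : List ℕ :=
  maxNorm r :: (List.ofFn r ++ List.ofFn fun u => encodeOutcome (μ u))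

end ManyToOne

/-! ### Polynomial time: random-access machines with logarithmic cost -/

namespace RAM

/-- The arithmetic operations; subtraction is truncated at zero. -/
inductive Arith
  | add
  | sub
  | mul

def Arith.eval : Arith → ℕ → ℕ → ℕ
  | .add, x, y => x + y
  | .sub, x, y => x - y
  | .mul, x, y => x * y

/-- Random-access machine programs in structured form. A program is a finite object: it names
finitely many registers and constants, and only `load` and `store` address the memory indirectly. -/
inductive Prog
  | skip
  | const (d c : ℕ)
  | copy (d a : ℕ)
  | arith (o : Arith) (d a b : ℕ)
  | load (d a : ℕ)
  | store (a b : ℕ)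
  | seq (p q : Prog)
  | ite (a : ℕ) (p q : Prog)
  | loop (a : ℕ) (p : Prog)

structure State where
  reg : ℕ → ℕ
  mem : ℕ → ℕ

def State.setReg (s : State) (d v : ℕ) : State := ⟨Function.update s.reg d v, s.mem⟩

def State.setMem (s : State) (i v : ℕ) : State := ⟨s.reg, Function.update s.mem i v⟩

/-- `Exec p s t s'`: started in the state `s`, the program `p` halts in the state `s'` at total cost
`t`. Logarithmic cost: each instruction and each test costs one plus the binary lengths of all
numbers (operands, and addresses used by indirect access) that it handles. The programs
`ite a p q` and `loop a p` test whether register `a` is nonzero. -/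
inductive Exec : Prog → State → ℕ → State → Prop
  | skip (s) : Exec .skip s 1 s
  | const (d c s) : Exec (.const d c) s (1 + c.size) (s.setReg d c)
  | copy (d a s) : Exec (.copy d a) s (1 + (s.reg a).size) (s.setReg d (s.reg a))
  | arith (o d a b s) : Exec (.arith o d a b) s (1 + (s.reg a).size + (s.reg b).size)
      (s.setReg d (o.eval (s.reg a) (s.reg b)))
  | load (d a s) : Exec (.load d a) s (1 + (s.reg a).size + (s.mem (s.reg a)).size)
      (s.setReg d (s.mem (s.reg a)))
  | store (a b s) : Exec (.store a b) s (1 + (s.reg a).size + (s.reg b).size)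
      (s.setMem (s.reg a) (s.reg b))
  | seq {p q s t s' t' s''} : Exec p s t s' → Exec q s' t' s'' → Exec (.seq p q) s (t + t') s''
  | ite_true {a p q s t s'} : s.reg a ≠ 0 → Exec p s t s' →
      Exec (.ite a p q) s (1 + (s.reg a).size + t) s'
  | ite_false {a p q s t s'} : s.reg a = 0 → Exec q s t s' →
      Exec (.ite a p q) s (1 + (s.reg a).size + t) s'
  | loop_done {a p s} : s.reg a = 0 → Exec (.loop a p) s (1 + (s.reg a).size) s
  | loop_next {a p s t s' t' s''} : s.reg a ≠ 0 → Exec p s t s' → Exec (.loop a p) s' t' s'' →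
      Exec (.loop a p) s (1 + (s.reg a).size + t + t') s''

/-- The input is in the memory cells `0, 1, 2, …`, its number of entries is in register `0`, and
everything else is zero. -/
def State.initial (x : List ℕ) : State where
  reg := fun i => if i = 0 then x.length else 0
  mem := fun i => x.getD i 0

/-- The output is read off in the same way; the other registers and cells do not matter. -/
def State.Holds (s : State) (y : List ℕ) : Prop :=
  s.reg 0 = y.length ∧ ∀ i (h : i < y.length), s.mem i = y[i]

/-- The length of a list of numbers written in binary, with one separator per number. -/
def bitLength (x : List ℕ) : ℕ := (x.map fun a => a.size + 1).sum

/-- One program maps, in time polynomial in the binary length of the input, the encoding of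
every `a` to an output that stands in the relation `R` to `a`. -/
def SolvableInPolyTime {α : Type} (enc : α → List ℕ) (R : α → List ℕ → Prop) : Prop :=
  ∃ (p : Prog) (T : Polynomial ℕ), ∀ a, ∃ t s y,
    Exec p (State.initial (enc a)) t s ∧ t ≤ T.eval (bitLength (enc a)) ∧ s.Holds y ∧ R a y

/-- The predicate `P` is decided in polynomial time, with output `1` for yes and `0` for no. -/
def DecidableInPolyTime {α : Type} (enc : α → List ℕ) (P : α → Prop) : Prop :=
  SolvableInPolyTime enc fun a y => (P a ∧ y = [1]) ∨ (¬ P a ∧ y = [0])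

end RAM

/-!
The combinatorial part rests on deferred acceptance in a form that leaves the order of rejections
open: a state records how often each student has been rejected, every student applies to the next
school on its list, and a student may be rejected when the school has at least as many better
applicants as it has places. A school that has rejected a student keeps enough better applicants
(`Market.Reachable.cap_le_card_rivals`), so the final state is a stable matching
(`Market.Terminal.isStable`). No student is ever rejected by a partner in a matching that is stable
for the same or for smaller capacities (`Market.Reachable.le_idxOf`), so the final matching is
student-optimal and every student weakly prefers it to all stable matchings for smaller capacities
(`Market.Terminal.weaklyPrefers`). Any `r` is dominated by the constant vector with entry
`maxNorm r`; hence, if the student-optimal stable matching for the constant increase `k` leaves a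
student unmatched, no `r` with entries at most `k` is feasible, and the first perfect matching of the
uniform-increment algorithm is optimal (`UniformReturns.isBestSolution`). With `n` additional places
at each school nobody is unmatched, so the loop ends.

For polynomial time, the algorithm is written in a small language whose loops and sums all range
over `0, …, L - 1`, where `L` is the length of the input. The number of machine steps of a compiled
command is then a polynomial in `L` that is read off from its text. The compiled code does not
multiply, so a step lengthens the numbers in the machine by at most one bit, and `N` steps on numbers
of `B` bits have logarithmic cost at most `N * (1 + 2 * (B + N))` (`ExecWithin`). This gives
`solvableInPolyTime_of_cmd`: only the effect of a command has to be studied, not its cost. All loops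
of the uniform-increment algorithm can have exactly `L` rounds: `L` exceeds the number of students,
which bounds the increments, and the total length of the preference lists, which bounds the number of
sweeps of deferred acceptance.
-/

namespace RAM

/-! ### Logarithmic cost of programs without multiplication -/

/-- All numbers in the registers and in the memory have binary length at most `B`. -/
def State.Bounded (s : State) (B : ℕ) : Prop :=
  (∀ i, (s.reg i).size ≤ B) ∧ ∀ i, (s.mem i).size ≤ B

/-- From `s` the program `p` halts in `s'` after what counts as `N` unit steps: a unit step lengthens
the numbers in the machine by at most one bit, so that, from numbers of length at most `B`, the
logarithmic cost is at most `N * (1 + 2 * (B + N))`. -/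
def ExecWithin (p : Prog) (s : State) (N : ℕ) (s' : State) : Prop :=
  ∀ B, s.Bounded B → s'.Bounded (B + N) ∧ ∃ t ≤ N * (1 + 2 * (B + N)), Exec p s t s'

theorem State.Bounded.mono {s : State} {B C : ℕ} (h : s.Bounded B) (hBC : B ≤ C) : s.Bounded C :=
  ⟨fun i => (h.1 i).trans hBC, fun i => (h.2 i).trans hBC⟩

theorem State.Bounded.setReg {s : State} {B v : ℕ} (h : s.Bounded B) (hv : v.size ≤ B) (d : ℕ) :
    (s.setReg d v).Bounded B := by
  refine ⟨fun i => ?_, h.2⟩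
  simp only [State.setReg, Function.update_apply]
  split_ifs
  · exact hv
  · exact h.1 i

theorem State.Bounded.setMem {s : State} {B v : ℕ} (h : s.Bounded B) (hv : v.size ≤ B) (d : ℕ) :
    (s.setMem d v).Bounded B := by
  refine ⟨h.1, fun i => ?_⟩
  simp only [State.setMem, Function.update_apply]
  split_ifs
  · exact hv
  · exact h.2 i

theorem ExecWithin.mono {p : Prog} {s s' : State} {N M : ℕ} (h : ExecWithin p s N s')
    (hNM : N ≤ M) : ExecWithin p s M s' := by
  intro B hB
  obtain ⟨h₁, t, ht, h₂⟩ := h B hB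
  exact ⟨h₁.mono (by omega), t, ht.trans (by gcongr), h₂⟩

theorem ExecWithin.seq {p q : Prog} {s s' s'' : State} {N M : ℕ} (hp : ExecWithin p s N s')
    (hq : ExecWithin q s' M s'') : ExecWithin (.seq p q) s (N + M) s'' := by
  intro B hB
  obtain ⟨h₁, t, ht, h₂⟩ := hp B hB
  obtain ⟨h₃, t', ht', h₄⟩ := hq _ h₁
  refine ⟨h₃.mono (by omega), t + t', ?_, h₂.seq h₄⟩
  nlinarith

theorem execWithin_skip (s : State) : ExecWithin .skip s 1 s := fun B hB =>
  ⟨hB.mono (by omega), 1, by omega, .skip s⟩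

theorem execWithin_const (d c : ℕ) (s : State) :
    ExecWithin (.const d c) s (c + 1) (s.setReg d c) := by
  intro B hB
  have hc : c.size ≤ c := Nat.size_le.2 Nat.lt_two_pow_self
  refine ⟨(hB.mono (by omega)).setReg (by omega) d, _, ?_, .const d c s⟩
  nlinarith

theorem execWithin_copy (d a : ℕ) (s : State) :
    ExecWithin (.copy d a) s 1 (s.setReg d (s.reg a)) := by
  intro B hB
  have := hB.1 a
  exact ⟨(hB.mono (by omega)).setReg (by omega) d, _, by omega, .copy d a s⟩

theorem execWithin_add (d a b : ℕ) (s : State) :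
    ExecWithin (.arith .add d a b) s 1 (s.setReg d (s.reg a + s.reg b)) := by
  intro B hB
  have ha := hB.1 a
  have hb := hB.1 b
  refine ⟨(hB.mono (by omega)).setReg ?_ d, _, by omega, .arith .add d a b s⟩
  rw [Nat.size_le] at *
  rw [pow_succ]
  omega

theorem execWithin_sub (d a b : ℕ) (s : State) :
    ExecWithin (.arith .sub d a b) s 1 (s.setReg d (s.reg a - s.reg b)) := by
  intro B hB
  have ha := hB.1 a
  have hb := hB.1 b
  refine ⟨(hB.mono (by omega)).setReg ?_ d, _, by omega, .arith .sub d a b s⟩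
  have := Nat.size_le_size (Nat.sub_le (s.reg a) (s.reg b))
  omega

theorem execWithin_load (d a : ℕ) (s : State) :
    ExecWithin (.load d a) s 1 (s.setReg d (s.mem (s.reg a))) := by
  intro B hB
  have ha := hB.1 a
  have hb := hB.2 (s.reg a)
  exact ⟨(hB.mono (by omega)).setReg (by omega) d, _, by omega, .load d a s⟩

theorem execWithin_store (a b : ℕ) (s : State) :
    ExecWithin (.store a b) s 1 (s.setMem (s.reg a) (s.reg b)) := by
  intro B hB
  have ha := hB.1 a
  have hb := hB.1 b
  exact ⟨(hB.mono (by omega)).setMem (by omega) _, _, by omega, .store a b s⟩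

theorem execWithin_ite {a : ℕ} {p q : Prog} {s s' : State} {N : ℕ}
    (hp : s.reg a ≠ 0 → ExecWithin p s N s') (hq : s.reg a = 0 → ExecWithin q s N s') :
    ExecWithin (.ite a p q) s (N + 1) s' := by
  intro B hB
  have ha := hB.1 a
  by_cases h : s.reg a = 0
  · obtain ⟨h₁, t, ht, h₂⟩ := hq h B hB
    exact ⟨h₁.mono (by omega), _, by nlinarith, .ite_false h h₂⟩
  · obtain ⟨h₁, t, ht, h₂⟩ := hp h B hB
    exact ⟨h₁.mono (by omega), _, by nlinarith, .ite_true h h₂⟩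

/-- A loop whose counter `c` falls from `L` to `0`, one by one; `J j` holds after `j` rounds. -/
theorem exists_execWithin_loop {c : ℕ} {p : Prog} {N L : ℕ} {J : ℕ → State → Prop}
    (hc : ∀ j s, J j s → s.reg c = L - j)
    (hp : ∀ j < L, ∀ s, J j s → ∃ s', ExecWithin p s N s' ∧ J (j + 1) s')
    {s : State} (hs : J 0 s) :
    ∃ s', ExecWithin (.loop c p) s (L * (N + 1) + 1) s' ∧ J L s' := by
  suffices H : ∀ i ≤ L, ∀ s, J (L - i) s →
      ∃ s', ExecWithin (.loop c p) s (i * (N + 1) + 1) s' ∧ J L s' from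
    H L le_rfl s (by simpa using hs)
  intro i
  induction i with
  | zero =>
    intro _ s hs
    refine ⟨s, fun B hB => ⟨hB.mono (by omega), _, ?_, .loop_done (by simpa using hc _ _ hs)⟩, hs⟩
    have := hB.1 c
    omega
  | succ i ih =>
    intro hi s hs
    obtain ⟨s', h₁, h₂⟩ := hp _ (by omega) s hs
    rw [show L - (i + 1) + 1 = L - i by omega] at h₂
    obtain ⟨s'', h₃, h₄⟩ := ih (by omega) s' h₂
    refine ⟨s'', fun B hB => ?_, h₄⟩
    obtain ⟨h₅, t, ht, h₆⟩ := h₁ B hB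
    obtain ⟨h₇, t', ht', h₈⟩ := h₃ _ h₅
    have := hB.1 c
    refine ⟨h₇.mono (by nlinarith), _, ?_, .loop_next (by have := hc _ _ hs; omega) h₆ h₈⟩
    generalize hM : i * (N + 1) + 1 = M at ht'
    rw [show (i + 1) * (N + 1) + 1 = N + M + 1 by rw [← hM]; ring]
    nlinarith

/-! ### A small language with bounded sums and bounded loops -/

/-- Expressions without side effects; `sum i e` is the sum of the values of `e` for
`i = 0, …, L - 1`, where `L` is the length of the input, and `ite c a b` tests whether `c` is
nonzero. -/
inductive Expr
  | const (c : ℕ)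
  | var (x : ℕ)
  | mem (e : Expr)
  | add (a b : Expr)
  | sub (a b : Expr)
  | ite (c a b : Expr)
  | sum (i : ℕ) (e : Expr)

/-- Commands; `rep i p` runs `p` for `i = 0, …, L - 1`, where `L` is the length of the input. As all
loops are of this kind, the number of steps is bounded by a polynomial in `L` that is read off from
the text of the command. -/
inductive Cmd
  | assign (x : ℕ) (e : Expr)
  | store (a e : Expr)
  | seq (p q : Cmd)
  | cond (c : Expr) (p : Cmd)
  | rep (i : ℕ) (p : Cmd)

/-- The value of an expression, with `L` as the bound of all sums. -/
def Expr.eval (L : ℕ) : Expr → State → ℕ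
  | const c, _ => c
  | var x, s => s.reg x
  | mem e, s => s.mem (e.eval L s)
  | add a b, s => a.eval L s + b.eval L s
  | sub a b, s => a.eval L s - b.eval L s
  | ite c a b, s => if c.eval L s ≠ 0 then a.eval L s else b.eval L s
  | sum i e, s => ∑ j ∈ Finset.range L, e.eval L (s.setReg i j)

/-- The state after `j` rounds of a loop over `i` with body `f`. -/
def iter (f : State → State) (i : ℕ) (s : State) : ℕ → State
  | 0 => s
  | j + 1 => f ((iter f i s j).setReg i j)

/-- The effect of a command, with `L` as the bound of all sums and loops. -/
def Cmd.run (L : ℕ) : Cmd → State → State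
  | assign x e, s => s.setReg x (e.eval L s)
  | store a e, s => s.setMem (a.eval L s) (e.eval L s)
  | seq p q, s => q.run L (p.run L s)
  | cond c p, s => if c.eval L s ≠ 0 then p.run L s else s
  | rep i p, s => iter (p.run L) i s L

/-- Compilation of an expression. The variable `x` is kept in register `2 * x` and the bound `L` in
register `1`; the value is left in register `2 * d + 1`, and of the odd registers only those from
there on are changed. The variable of a sum is saved before and restored after the summation. -/
def Expr.compile : Expr → ℕ → Prog
  | const c, d => .const (2 * d + 1) c
  | var x, d => .copy (2 * d + 1) (2 * x)
  | mem e, d => .seq (e.compile d) (.load (2 * d + 1) (2 * d + 1))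
  | add a b, d => .seq (a.compile d) (.seq (b.compile (d + 1))
      (.arith .add (2 * d + 1) (2 * d + 1) (2 * (d + 1) + 1)))
  | sub a b, d => .seq (a.compile d) (.seq (b.compile (d + 1))
      (.arith .sub (2 * d + 1) (2 * d + 1) (2 * (d + 1) + 1)))
  | ite c a b, d => .seq (c.compile d) (.ite (2 * d + 1) (a.compile d) (b.compile d))
  | sum i e, d => .seq (.const (2 * d + 1) 0) <| .seq (.copy (2 * (d + 1) + 1) (2 * i)) <|
      .seq (.copy (2 * (d + 2) + 1) 1) <| .seq
        (.loop (2 * (d + 2) + 1) <| .seq (.arith .sub (2 * i) 1 (2 * (d + 2) + 1)) <|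
          .seq (e.compile (d + 3)) <|
          .seq (.arith .add (2 * d + 1) (2 * d + 1) (2 * (d + 3) + 1)) <|
          .seq (.const (2 * (d + 3) + 1) 1) <|
          .arith .sub (2 * (d + 2) + 1) (2 * (d + 2) + 1) (2 * (d + 3) + 1))
        (.copy (2 * i) (2 * (d + 1) + 1))

/-- Compilation of a command, with the registers used as for expressions. -/
def Cmd.compile : Cmd → ℕ → Prog
  | assign x e, d => .seq (e.compile d) (.copy (2 * x) (2 * d + 1))
  | store a e, d => .seq (a.compile d) (.seq (e.compile (d + 1))
      (.store (2 * d + 1) (2 * (d + 1) + 1)))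
  | seq p q, d => .seq (p.compile d) (q.compile d)
  | cond c p, d => .seq (c.compile d) (.ite (2 * d + 1) (p.compile d) .skip)
  | rep i p, d => .seq (.copy (2 * d + 1) 1) <|
      .loop (2 * d + 1) <| .seq (.arith .sub (2 * i) 1 (2 * d + 1)) <|
        .seq (p.compile (d + 1)) <|
        .seq (.const (2 * (d + 1) + 1) 1) <|
        .arith .sub (2 * d + 1) (2 * d + 1) (2 * (d + 1) + 1)

open Polynomial in
/-- The number of unit steps of a compiled expression, as a polynomial in the bound `L`. -/
noncomputable def Expr.time : Expr → ℕ[X]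
  | const c => C (c + 1)
  | var _ => 1
  | mem e => e.time + 1
  | add a b => a.time + (b.time + 1)
  | sub a b => a.time + (b.time + 1)
  | ite c a b => c.time + (a.time + b.time + 1)
  | sum _ e => 1 + (1 + (1 + (X * (1 + (e.time + (1 + (2 + 1))) + 1) + 1 + 1)))

open Polynomial in
/-- The number of unit steps of a compiled command, as a polynomial in the bound `L`. -/
noncomputable def Cmd.time : Cmd → ℕ[X]
  | assign _ e => e.time + 1
  | store a e => a.time + (e.time + 1)
  | seq p q => p.time + q.time
  | cond c p => c.time + (p.time + 1 + 1)
  | rep _ p => 1 + (X * (1 + (p.time + (2 + 1)) + 1) + 1)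

/-- The variables and the memory, as seen by the uncompiled language. -/
def State.view (s : State) : State := ⟨fun x => s.reg (2 * x), s.mem⟩

theorem State.view_setReg_odd (s : State) (d v : ℕ) : (s.setReg (2 * d + 1) v).view = s.view := by
  simp only [State.view, State.setReg, State.mk.injEq, and_true]
  ext x
  rw [Function.update_of_ne (by omega)]

theorem State.view_setReg_even (s : State) (x v : ℕ) :
    (s.setReg (2 * x) v).view = s.view.setReg x v := by
  simp only [State.view, State.setReg, State.mk.injEq, and_true]
  ext y
  by_cases h : y = x
  · simp [h]
  · rw [Function.update_of_ne (by omega), Function.update_of_ne h]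

theorem State.view_setMem (s : State) (i v : ℕ) : (s.setMem i v).view = s.view.setMem i v := rfl

theorem State.setReg_reg_self (s : State) (d v : ℕ) : (s.setReg d v).reg d = v := by
  simp [State.setReg]

theorem State.setReg_reg_of_ne (s : State) {d e : ℕ} (v : ℕ) (h : e ≠ d) :
    (s.setReg d v).reg e = s.reg e := by
  simp [State.setReg, h]

theorem State.setMem_reg (s : State) (i v e : ℕ) : (s.setMem i v).reg e = s.reg e := rfl

theorem State.setReg_setReg (s : State) (d v w : ℕ) :
    (s.setReg d v).setReg d w = s.setReg d w := by
  simp [State.setReg]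

theorem State.setReg_reg (s : State) (d : ℕ) : s.setReg d (s.reg d) = s := by
  simp [State.setReg]

/-- The compiled expression has no effect on the variables, the memory and the odd registers below
`2 * d + 1`, where enclosing code keeps its intermediate results, and in particular none on the
bound `L` in register `1`. -/
theorem Expr.compile_correct (L : ℕ) (e : Expr) (d : ℕ) (hd : 1 ≤ d) (s : State)
    (hL : s.reg 1 = L) : ∃ s', ExecWithin (e.compile d) s (e.time.eval L) s' ∧
      s'.view = s.view ∧ (∀ t < d, s'.reg (2 * t + 1) = s.reg (2 * t + 1)) ∧
      s'.reg (2 * d + 1) = e.eval L s.view := by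
  induction e generalizing d s with
  | const c =>
    refine ⟨_, ?_, s.view_setReg_odd d c, fun t ht => s.setReg_reg_of_ne _ (by omega),
      s.setReg_reg_self _ _⟩
    simpa [Expr.time, Expr.compile] using execWithin_const (2 * d + 1) c s
  | var x =>
    refine ⟨s.setReg (2 * d + 1) (s.reg (2 * x)), ?_, s.view_setReg_odd d _,
      fun t ht => s.setReg_reg_of_ne _ (by omega), s.setReg_reg_self _ _⟩
    simpa [Expr.time, Expr.compile] using execWithin_copy (2 * d + 1) (2 * x) s
  | mem e ih =>
    obtain ⟨s₁, h₁, v₁, t₁, r₁⟩ := ih d hd s hL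
    refine ⟨s₁.setReg (2 * d + 1) (s₁.mem (s₁.reg (2 * d + 1))), ?_,
      (s₁.view_setReg_odd d _).trans v₁,
      fun t ht => (s₁.setReg_reg_of_ne _ (by omega)).trans (t₁ t ht), ?_⟩
    · simpa [Expr.time, Expr.compile] using h₁.seq (execWithin_load (2 * d + 1) (2 * d + 1) s₁)
    · rw [State.setReg_reg_self, r₁]
      exact congrFun (congrArg State.mem v₁) _
  | add a b iha ihb =>
    obtain ⟨s₁, h₁, v₁, t₁, r₁⟩ := iha d hd s hL
    obtain ⟨s₂, h₂, v₂, t₂, r₂⟩ := ihb (d + 1) (by omega) s₁ ((t₁ 0 (by omega)).trans hL)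
    refine ⟨s₂.setReg (2 * d + 1) (s₂.reg (2 * d + 1) + s₂.reg (2 * (d + 1) + 1)), ?_,
      ((s₂.view_setReg_odd d _).trans v₂).trans v₁,
      fun t ht => (s₂.setReg_reg_of_ne _ (by omega)).trans
        ((t₂ t (by omega)).trans (t₁ t ht)), ?_⟩
    · simpa [Expr.time, Expr.compile] using
        h₁.seq (h₂.seq (execWithin_add (2 * d + 1) (2 * d + 1) (2 * (d + 1) + 1) s₂))
    · rw [State.setReg_reg_self, r₂, t₂ d (by omega), r₁, v₁]
      rfl
  | sub a b iha ihb =>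
    obtain ⟨s₁, h₁, v₁, t₁, r₁⟩ := iha d hd s hL
    obtain ⟨s₂, h₂, v₂, t₂, r₂⟩ := ihb (d + 1) (by omega) s₁ ((t₁ 0 (by omega)).trans hL)
    refine ⟨s₂.setReg (2 * d + 1) (s₂.reg (2 * d + 1) - s₂.reg (2 * (d + 1) + 1)), ?_,
      ((s₂.view_setReg_odd d _).trans v₂).trans v₁,
      fun t ht => (s₂.setReg_reg_of_ne _ (by omega)).trans
        ((t₂ t (by omega)).trans (t₁ t ht)), ?_⟩
    · simpa [Expr.time, Expr.compile] using
        h₁.seq (h₂.seq (execWithin_sub (2 * d + 1) (2 * d + 1) (2 * (d + 1) + 1) s₂))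
    · rw [State.setReg_reg_self, r₂, t₂ d (by omega), r₁, v₁]
      rfl
  | ite c a b ihc iha ihb =>
    obtain ⟨s₁, h₁, v₁, t₁, r₁⟩ := ihc d hd s hL
    have hL₁ : s₁.reg 1 = L := (t₁ 0 (by omega)).trans hL
    by_cases hc : c.eval L s.view = 0
    · obtain ⟨s₂, h₂, v₂, t₂, r₂⟩ := ihb d hd s₁ hL₁
      refine ⟨s₂, ?_, v₂.trans v₁, fun t ht => (t₂ t ht).trans (t₁ t ht), ?_⟩
      · simp only [Expr.time, Polynomial.eval_add, Polynomial.eval_one]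
        exact h₁.seq (execWithin_ite (fun h => absurd (r₁.trans hc) h)
          fun _ => h₂.mono (by omega))
      · rw [r₂, v₁]
        simp [Expr.eval, hc]
    · obtain ⟨s₂, h₂, v₂, t₂, r₂⟩ := iha d hd s₁ hL₁
      refine ⟨s₂, ?_, v₂.trans v₁, fun t ht => (t₂ t ht).trans (t₁ t ht), ?_⟩
      · simp only [Expr.time, Polynomial.eval_add, Polynomial.eval_one]
        exact h₁.seq (execWithin_ite (fun _ => h₂.mono (by omega))
          fun h => absurd (r₁.symm.trans h) hc)
      · rw [r₂, v₁]
        simp [Expr.eval, hc]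
  | sum i e ih =>
    -- acc = register `2 * d + 1`, saved variable = `2 * (d + 1) + 1`, counter = `2 * (d + 2) + 1`
    set s₁ := s.setReg (2 * d + 1) 0 with hs₁
    set s₂ := s₁.setReg (2 * (d + 1) + 1) (s₁.reg (2 * i)) with hs₂
    set s₃ := s₂.setReg (2 * (d + 2) + 1) (s₂.reg 1) with hs₃
    let J : ℕ → State → Prop := fun j τ =>
      τ.view.setReg i (s.view.reg i) = s.view ∧
      (∀ t < d, τ.reg (2 * t + 1) = s.reg (2 * t + 1)) ∧
      τ.reg (2 * d + 1) = ∑ j ∈ Finset.range j, e.eval L (s.view.setReg i j) ∧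
      τ.reg (2 * (d + 1) + 1) = s.view.reg i ∧ τ.reg (2 * (d + 2) + 1) = L - j
    have hJ : J 0 s₃ := by
      refine ⟨?_, fun t ht => ?_, ?_, ?_, ?_⟩
      · rw [hs₃, State.view_setReg_odd, hs₂, State.view_setReg_odd, hs₁, State.view_setReg_odd,
          State.setReg_reg]
      · rw [hs₃, State.setReg_reg_of_ne _ _ (by omega), hs₂,
          State.setReg_reg_of_ne _ _ (by omega), hs₁, State.setReg_reg_of_ne _ _ (by omega)]
      · rw [hs₃, State.setReg_reg_of_ne _ _ (by omega), hs₂,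
          State.setReg_reg_of_ne _ _ (by omega), hs₁, State.setReg_reg_self]
        simp
      · rw [hs₃, State.setReg_reg_of_ne _ _ (by omega), hs₂, State.setReg_reg_self, hs₁,
          State.setReg_reg_of_ne _ _ (by omega)]
        rfl
      · rw [hs₃, State.setReg_reg_self, hs₂, State.setReg_reg_of_ne _ _ (by omega), hs₁,
          State.setReg_reg_of_ne _ _ (by omega), hL, Nat.sub_zero]
    obtain ⟨s₄, h₄, v₄, t₄, a₄, b₄, -⟩ := exists_execWithin_loop (c := 2 * (d + 2) + 1) (L := L)
      (p := .seq (.arith .sub (2 * i) 1 (2 * (d + 2) + 1)) <|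
          .seq (e.compile (d + 3)) <|
          .seq (.arith .add (2 * d + 1) (2 * d + 1) (2 * (d + 3) + 1)) <|
          .seq (.const (2 * (d + 3) + 1) 1) <|
          .arith .sub (2 * (d + 2) + 1) (2 * (d + 2) + 1) (2 * (d + 3) + 1))
      (N := 1 + (e.time.eval L + (1 + (2 + 1)))) (J := J) (fun j τ h => h.2.2.2.2) (by
        rintro j hj τ ⟨vτ, tτ, aτ, bτ, cτ⟩
        have hτ : τ.reg 1 = L := (tτ 0 (by omega)).trans hL
        set u₁ := τ.setReg (2 * i) (τ.reg 1 - τ.reg (2 * (d + 2) + 1)) with hu₁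
        have w₁ : u₁.view = s.view.setReg i j := by
          rw [hu₁, State.view_setReg_even, hτ, cτ, ← vτ, State.setReg_setReg]
          congr 1
          omega
        obtain ⟨u₂, g₂, w₂, q₂, r₂⟩ := ih (d + 3) (by omega) u₁
          ((State.setReg_reg_of_ne _ _ (by omega)).trans hτ)
        rw [w₁] at w₂ r₂
        have q₂' : ∀ t < d + 3, u₂.reg (2 * t + 1) = τ.reg (2 * t + 1) := fun t ht =>
          (q₂ t ht).trans (State.setReg_reg_of_ne _ _ (by omega))
        set u₃ := u₂.setReg (2 * d + 1) (u₂.reg (2 * d + 1) + u₂.reg (2 * (d + 3) + 1)) with hu₃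
        set u₄ := u₃.setReg (2 * (d + 3) + 1) 1 with hu₄
        refine ⟨_, (execWithin_sub _ _ _ τ).seq (g₂.seq ((execWithin_add _ _ _ u₂).seq
          ((execWithin_const _ _ u₃).seq (execWithin_sub _ _ _ u₄)))), ?_, fun t ht => ?_,
          ?_, ?_, ?_⟩
        · rw [State.view_setReg_odd, hu₄, State.view_setReg_odd, hu₃, State.view_setReg_odd, w₂,
            State.setReg_setReg, State.setReg_reg]
        · rw [State.setReg_reg_of_ne _ _ (by omega), hu₄, State.setReg_reg_of_ne _ _ (by omega),
            hu₃, State.setReg_reg_of_ne _ _ (by omega), q₂' t (by omega), tτ t ht]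
        · rw [State.setReg_reg_of_ne _ _ (by omega), hu₄, State.setReg_reg_of_ne _ _ (by omega),
            hu₃, State.setReg_reg_self, q₂' d (by omega), aτ, r₂, Finset.sum_range_succ]
        · rw [State.setReg_reg_of_ne _ _ (by omega), hu₄, State.setReg_reg_of_ne _ _ (by omega),
            hu₃, State.setReg_reg_of_ne _ _ (by omega), q₂' _ (by omega), bτ]
        · rw [State.setReg_reg_self, hu₄, State.setReg_reg_self,
            State.setReg_reg_of_ne _ _ (by omega), hu₃, State.setReg_reg_of_ne _ _ (by omega),
            q₂' _ (by omega), cτ]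
          omega) hJ
    refine ⟨s₄.setReg (2 * i) (s₄.reg (2 * (d + 1) + 1)), ?_, ?_, fun t ht => ?_, ?_⟩
    · simpa [Expr.time, Expr.compile] using (execWithin_const (2 * d + 1) 0 s).seq
        ((execWithin_copy (2 * (d + 1) + 1) (2 * i) s₁).seq
        ((execWithin_copy (2 * (d + 2) + 1) 1 s₂).seq
        (h₄.seq (execWithin_copy (2 * i) (2 * (d + 1) + 1) s₄))))
    · rw [State.view_setReg_even, b₄, v₄]
    · rw [State.setReg_reg_of_ne _ _ (by omega), t₄ t ht]
    · rw [State.setReg_reg_of_ne _ _ (by omega), a₄]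
      rfl

theorem Cmd.compile_correct (L : ℕ) (c : Cmd) (d : ℕ) (hd : 1 ≤ d) (s : State)
    (hL : s.reg 1 = L) : ∃ s', ExecWithin (c.compile d) s (c.time.eval L) s' ∧
      s'.view = c.run L s.view ∧ ∀ t < d, s'.reg (2 * t + 1) = s.reg (2 * t + 1) := by
  induction c generalizing d s with
  | assign x e =>
    obtain ⟨s₁, h₁, v₁, t₁, r₁⟩ := e.compile_correct L d hd s hL
    refine ⟨s₁.setReg (2 * x) (s₁.reg (2 * d + 1)), ?_, ?_,
      fun t ht => (s₁.setReg_reg_of_ne _ (by omega)).trans (t₁ t ht)⟩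
    · simpa [Cmd.time, Cmd.compile] using h₁.seq (execWithin_copy (2 * x) (2 * d + 1) s₁)
    · rw [State.view_setReg_even, v₁, r₁]
      rfl
  | store a e =>
    obtain ⟨s₁, h₁, v₁, t₁, r₁⟩ := a.compile_correct L d hd s hL
    obtain ⟨s₂, h₂, v₂, t₂, r₂⟩ := e.compile_correct L (d + 1) (by omega) s₁
      ((t₁ 0 (by omega)).trans hL)
    refine ⟨s₂.setMem (s₂.reg (2 * d + 1)) (s₂.reg (2 * (d + 1) + 1)), ?_, ?_,
      fun t ht => (t₂ t (by omega)).trans (t₁ t ht)⟩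
    · simpa [Cmd.time, Cmd.compile] using h₁.seq (h₂.seq (execWithin_store (2 * d + 1) (2 * (d + 1) + 1) s₂))
    · rw [State.view_setMem, v₂, r₂, t₂ d (by omega), r₁, v₁]
      rfl
  | seq p q ihp ihq =>
    obtain ⟨s₁, h₁, v₁, t₁⟩ := ihp d hd s hL
    obtain ⟨s₂, h₂, v₂, t₂⟩ := ihq d hd s₁ ((t₁ 0 (by omega)).trans hL)
    refine ⟨s₂, ?_, ?_, fun t ht => (t₂ t ht).trans (t₁ t ht)⟩
    · simpa [Cmd.time, Cmd.compile] using h₁.seq h₂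
    · rw [v₂, v₁]
      rfl
  | cond c p ih =>
    obtain ⟨s₁, h₁, v₁, t₁, r₁⟩ := c.compile_correct L d hd s hL
    by_cases hc : c.eval L s.view = 0
    · refine ⟨s₁, ?_, ?_, t₁⟩
      · simp only [Cmd.time, Polynomial.eval_add, Polynomial.eval_one]
        exact h₁.seq (execWithin_ite (fun h => absurd (r₁.trans hc) h)
          fun _ => (execWithin_skip s₁).mono (by omega))
      · simp [Cmd.run, hc, v₁]
    · obtain ⟨s₂, h₂, v₂, t₂⟩ := ih d hd s₁ ((t₁ 0 (by omega)).trans hL)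
      refine ⟨s₂, ?_, ?_, fun t ht => (t₂ t ht).trans (t₁ t ht)⟩
      · simp only [Cmd.time, Polynomial.eval_add, Polynomial.eval_one]
        exact h₁.seq (execWithin_ite (fun _ => h₂.mono (by omega))
          fun h => absurd (r₁.symm.trans h) hc)
      · simp [Cmd.run, hc, v₂, v₁]
  | rep i p ih =>
    set s₁ := s.setReg (2 * d + 1) (s.reg 1) with hs₁
    let J : ℕ → State → Prop := fun j τ =>
      τ.view = iter (p.run L) i s.view j ∧
      (∀ t < d, τ.reg (2 * t + 1) = s.reg (2 * t + 1)) ∧ τ.reg (2 * d + 1) = L - j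
    have hJ : J 0 s₁ := by
      refine ⟨State.view_setReg_odd _ _ _, fun t ht => State.setReg_reg_of_ne _ _ (by omega), ?_⟩
      rw [hs₁, State.setReg_reg_self, hL, Nat.sub_zero]
    obtain ⟨s₂, h₂, v₂, t₂, -⟩ := exists_execWithin_loop (c := 2 * d + 1) (L := L)
      (p := .seq (.arith .sub (2 * i) 1 (2 * d + 1)) <|
        .seq (p.compile (d + 1)) <|
        .seq (.const (2 * (d + 1) + 1) 1) <|
        .arith .sub (2 * d + 1) (2 * d + 1) (2 * (d + 1) + 1))
      (N := 1 + (p.time.eval L + (2 + 1))) (J := J) (fun j τ h => h.2.2) (by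
        rintro j hj τ ⟨vτ, tτ, cτ⟩
        have hτ : τ.reg 1 = L := (tτ 0 (by omega)).trans hL
        set u₁ := τ.setReg (2 * i) (τ.reg 1 - τ.reg (2 * d + 1)) with hu₁
        have w₁ : u₁.view = (iter (p.run L) i s.view j).setReg i j := by
          rw [hu₁, State.view_setReg_even, hτ, cτ, ← vτ]
          congr 1
          omega
        obtain ⟨u₂, g₂, w₂, q₂⟩ := ih (d + 1) (by omega) u₁
          ((State.setReg_reg_of_ne _ _ (by omega)).trans hτ)
        have q₂' : ∀ t < d + 1, u₂.reg (2 * t + 1) = τ.reg (2 * t + 1) := fun t ht =>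
          (q₂ t ht).trans (State.setReg_reg_of_ne _ _ (by omega))
        set u₃ := u₂.setReg (2 * (d + 1) + 1) 1 with hu₃
        refine ⟨_, (execWithin_sub _ _ _ τ).seq (g₂.seq
          ((execWithin_const _ _ u₂).seq (execWithin_sub _ _ _ u₃))), ?_, fun t ht => ?_, ?_⟩
        · rw [State.view_setReg_odd, hu₃, State.view_setReg_odd, w₂, w₁]
          rfl
        · rw [State.setReg_reg_of_ne _ _ (by omega), hu₃, State.setReg_reg_of_ne _ _ (by omega),
            q₂' t (by omega), tτ t ht]
        · rw [State.setReg_reg_self, hu₃, State.setReg_reg_self,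
            State.setReg_reg_of_ne _ _ (by omega), q₂' d (by omega), cτ]
          omega) hJ
    refine ⟨s₂, ?_, v₂, t₂⟩
    simpa [Cmd.time, Cmd.compile] using (execWithin_copy (2 * d + 1) 1 s).seq h₂

theorem eval_mono (P : Polynomial ℕ) {a b : ℕ} (h : a ≤ b) : P.eval a ≤ P.eval b := by
  simp only [Polynomial.eval_eq_sum, Polynomial.sum]
  gcongr

theorem length_le_bitLength (x : List ℕ) : x.length ≤ bitLength x := by
  induction x with
  | nil => simp [bitLength]
  | cons a x ih =>
    simp only [bitLength, List.map_cons, List.sum_cons, List.length_cons] at *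
    omega

theorem size_lt_bitLength {x : List ℕ} {a : ℕ} (h : a ∈ x) : a.size < bitLength x :=
  List.le_sum_of_mem (List.mem_map.2 ⟨a, h, rfl⟩ : a.size + 1 ∈ x.map fun a => a.size + 1)

theorem State.initial_bounded (x : List ℕ) : (State.initial x).Bounded (bitLength x) := by
  refine ⟨fun i => ?_, fun i => ?_⟩
  · simp only [State.initial]
    split_ifs
    · exact (Nat.size_le.2 Nat.lt_two_pow_self).trans (length_le_bitLength x)
    · simp
  · simp only [State.initial, List.getD_eq_getElem?_getD]
    by_cases hi : i < x.length
    · simpa [hi] using (size_lt_bitLength (List.getElem_mem hi)).le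
    · simp [hi]

/-- A problem that is solved by a command of the small language is solvable in polynomial time. -/
theorem solvableInPolyTime_of_cmd (c : Cmd) {α : Type} (enc : α → List ℕ)
    (R : α → List ℕ → Prop)
    (h : ∀ a, ∃ y, (c.run (enc a).length (State.initial (enc a))).Holds y ∧ R a y) :
    SolvableInPolyTime enc R := by
  set P : Polynomial ℕ := 1 + c.time
  refine ⟨.seq (.copy 1 0) (c.compile 1), P * (1 + 2 * (Polynomial.X + P)), fun a => ?_⟩
  set x := enc a
  obtain ⟨y, hy, hR⟩ := h a
  set s := (State.initial x).setReg 1 ((State.initial x).reg 0) with hs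
  have hv : s.view = State.initial x := by
    rw [hs, State.view_setReg_odd (State.initial x) 0]
    simp [State.view, State.initial]
  obtain ⟨s', h₁, v₁, -⟩ := c.compile_correct x.length 1 le_rfl s
    (State.setReg_reg_self _ _ _)
  obtain ⟨-, t, ht, hE⟩ := ((execWithin_copy 1 0 (State.initial x)).seq h₁) _
    (State.initial_bounded x)
  refine ⟨t, s', y, hE, ht.trans ?_, ?_, hR⟩
  · have := eval_mono c.time (length_le_bitLength x)
    simp only [P, Polynomial.eval_mul, Polynomial.eval_add, Polynomial.eval_one,
      Polynomial.eval_X, Polynomial.eval_ofNat]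
    gcongr
  · rw [hv] at v₁
    rw [← v₁] at hy
    exact hy

end RAM

namespace ManyToOne

variable {n m : ℕ}

/-! ### Deferred acceptance -/

instance {k : ℕ} (l : List (Fin k)) (a b : Fin k) : Decidable (Precedes l a b) :=
  inferInstanceAs (Decidable (_ ∧ _ ∧ _))

/-- The schools to which the students apply when `p u` counts the rejections of student `u`: the
next school on the list, or none if the list is exhausted. -/
def Market.target (I : Market n m) (p : Fin n → ℕ) : Assignment n m := fun u => (I.pref u)[p u]?

/-- The applicants of school `w` that it ranks above `u`. -/
def Market.rivals (I : Market n m) (p : Fin n → ℕ) (u : Fin n) (w : Fin m) : Finset (Fin n) :=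
  Finset.univ.filter fun v => I.target p v = some w ∧ Precedes (I.prio w) v u

/-- The student `u` is to be rejected: the school has enough applicants that it ranks above `u`. -/
def Market.Rejects (I : Market n m) (p : Fin n → ℕ) (u : Fin n) : Prop :=
  ∃ w, I.target p u = some w ∧ I.cap w ≤ (I.rivals p u w).card

/-- The rejection counts that occur in some run of deferred acceptance, in which the rejections may
be made in any order. -/
inductive Market.Reachable (I : Market n m) : (Fin n → ℕ) → Prop
  | zero : I.Reachable fun _ => 0
  | reject {p u} : I.Reachable p → I.Rejects p u → I.Reachable (Function.update p u (p u + 1))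

/-- The rejection counts at the end of a run of deferred acceptance. -/
def Market.Terminal (I : Market n m) (p : Fin n → ℕ) : Prop :=
  I.Reachable p ∧ ∀ u, ¬ I.Rejects p u

theorem Market.target_eq_some_iff (I : Market n m) {p : Fin n → ℕ} {u : Fin n} {w : Fin m} :
    I.target p u = some w ↔ w ∈ I.pref u ∧ (I.pref u).idxOf w = p u := by
  rw [Market.target, List.getElem?_eq_some_iff]
  constructor
  · rintro ⟨h, rfl⟩
    exact ⟨List.getElem_mem h, (I.pref_nodup u).idxOf_getElem _ h⟩
  · rintro ⟨h, h'⟩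
    have hl := List.idxOf_lt_length_iff.2 h
    refine ⟨h' ▸ hl, ?_⟩
    simp only [← h', List.getElem_idxOf]

theorem Market.target_eq_none_iff (I : Market n m) {p : Fin n → ℕ} {u : Fin n} :
    I.target p u = none ↔ (I.pref u).length ≤ p u := List.getElem?_eq_none_iff

theorem Market.mem_rivals (I : Market n m) {p : Fin n → ℕ} {u v : Fin n} {w : Fin m} :
    v ∈ I.rivals p u w ↔ I.target p v = some w ∧ Precedes (I.prio w) v u := by
  simp [Market.rivals]

theorem Market.target_update_of_ne (I : Market n m) (p : Fin n → ℕ) {u v : Fin n} (a : ℕ)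
    (h : v ≠ u) : I.target (Function.update p u a) v = I.target p v := by
  simp [Market.target, h]

theorem Market.Reachable.le_length {I : Market n m} {p : Fin n → ℕ} (h : I.Reachable p)
    (u : Fin n) : p u ≤ (I.pref u).length := by
  induction h with
  | zero => exact Nat.zero_le _
  | @reject p v _ hr ih =>
    by_cases huv : u = v
    · subst huv
      obtain ⟨w, hw, -⟩ := hr
      rw [I.target_eq_some_iff] at hw
      have := List.idxOf_lt_length_iff.2 hw.1
      simp only [Function.update_self]
      omega
    · simpa [huv] using ih

/-- A school that has rejected `u` keeps enough applicants that it ranks above `u`. -/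
theorem Market.Reachable.cap_le_card_rivals {I : Market n m} {p : Fin n → ℕ} (h : I.Reachable p)
    {u : Fin n} {w : Fin m} (hw : w ∈ I.pref u) (hp : (I.pref u).idxOf w < p u) :
    I.cap w ≤ (I.rivals p u w).card := by
  induction h generalizing u w with
  | zero => exact absurd hp (Nat.not_lt_zero _)
  | @reject p u₀ _ hr ih =>
    obtain ⟨w₀, hw₀, hc⟩ := hr
    by_cases hu : u₀ ∈ I.rivals p u w
    · -- `w` now rejects a rival of `u`; the rivals of that rival remain
      rw [I.mem_rivals] at hu
      obtain rfl : w₀ = w := by simpa using hw₀.symm.trans hu.1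
      refine hc.trans (Finset.card_le_card fun v hv => ?_)
      rw [I.mem_rivals] at hv ⊢
      have hne : v ≠ u₀ := by
        rintro rfl
        exact lt_irrefl _ hv.2.2.2
      rw [I.target_update_of_ne p _ hne]
      exact ⟨hv.1, hv.2.1, hu.2.2.1, hv.2.2.2.trans hu.2.2.2⟩
    · have hsub : I.rivals p u w ⊆ I.rivals (Function.update p u₀ (p u₀ + 1)) u w := by
        intro v hv
        have hne : v ≠ u₀ := by
          rintro rfl
          exact hu hv
        rw [I.mem_rivals] at hv ⊢
        rwa [I.target_update_of_ne p _ hne]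
      refine le_trans ?_ (Finset.card_le_card hsub)
      by_cases huv : u = u₀
      · subst huv
        rw [Function.update_self] at hp
        rcases Nat.lt_succ_iff_lt_or_eq.1 hp with hp | hp
        · exact ih hw hp
        · obtain rfl : w₀ = w := by simpa using hw₀.symm.trans (I.target_eq_some_iff.2 ⟨hw, hp⟩)
          exact hc
      · rw [Function.update_of_ne huv] at hp
        exact ih hw hp

/-- No student is rejected by a school that is assigned to it in a matching that is stable for
smaller capacities: if such a rejection comes first, one of the applicants that caused it
forms a blocking pair with the school. -/
theorem Market.Reachable.le_idxOf {I J : Market n m} (hpref : J.pref = I.pref)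
    (hprio : J.prio = I.prio) (hcap : ∀ w, J.cap w ≤ I.cap w) {σ : Assignment n m}
    (hσ : J.IsStable σ) {p : Fin n → ℕ} (h : I.Reachable p) {u : Fin n} {w : Fin m}
    (hu : σ u = some w) : p u ≤ (I.pref u).idxOf w := by
  induction h generalizing u w with
  | zero => exact Nat.zero_le _
  | @reject p u₀ _ hr ih =>
    by_cases huv : u = u₀
    · subst huv
      rw [Function.update_self]
      refine Nat.succ_le_of_lt (lt_of_le_of_ne (ih hu) fun heq => ?_)
      obtain ⟨w₀, hw₀, hc⟩ := hr
      have hwu : w ∈ I.pref u := hpref ▸ hσ.1 u w hu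
      obtain rfl : w₀ = w := by
        simpa using hw₀.symm.trans (I.target_eq_some_iff.2 ⟨hwu, heq.symm⟩)
      -- some rival of `u` is not assigned to `w₀`, as `u` takes one of the places there
      obtain ⟨v, hv, hvσ⟩ : ∃ v ∈ I.rivals p u w₀, σ v ≠ some w₀ := by
        by_contra! hall
        have hlt : (I.rivals p u w₀).card < load σ w₀ := by
          refine Finset.card_lt_card ⟨fun v hv => by simpa using hall v hv, fun hsub => ?_⟩
          have := hsub (show u ∈ _ by simpa using hu)
          rw [I.mem_rivals] at this
          exact lt_irrefl _ this.2.2.2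
        have := hσ.2.1 w₀
        have := hcap w₀
        omega
      rw [I.mem_rivals] at hv
      have hv' := I.target_eq_some_iff.1 hv.1
      refine hσ.2.2 v w₀ ⟨hprio ▸ hv.2.1, ?_, .inr ⟨u, hu, hprio ▸ hv.2⟩⟩
      cases hσv : σ v with
      | none =>
        show w₀ ∈ J.pref v
        rw [hpref]
        exact hv'.1
      | some w' =>
        have hw' : w' ∈ I.pref v := hpref ▸ hσ.1 v w' hσv
        show Precedes (J.pref v) w₀ w'
        rw [hpref]
        refine ⟨hv'.1, hw', lt_of_le_of_ne (hv'.2 ▸ ih hσv) fun hne => hvσ ?_⟩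
        rw [hσv, (List.idxOf_inj hv'.1).1 hne]
    · rw [Function.update_of_ne huv]
      exact ih hu

/-- Every student weakly prefers the outcome of deferred acceptance to every matching that is stable
for smaller capacities. -/
theorem Market.Terminal.weaklyPrefers {I J : Market n m} (hpref : J.pref = I.pref)
    (hprio : J.prio = I.prio) (hcap : ∀ w, J.cap w ≤ I.cap w) {σ : Assignment n m}
    (hσ : J.IsStable σ) {p : Fin n → ℕ} (h : I.Terminal p) (u : Fin n) :
    I.WeaklyPrefers u (I.target p u) (σ u) := by
  cases hσu : σ u with
  | none =>
    cases ht : I.target p u with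
    | none => exact .inl rfl
    | some w => exact .inr (I.target_eq_some_iff.1 ht).1
  | some w =>
    have hw : w ∈ I.pref u := hpref ▸ hσ.1 u w hσu
    have hle := h.1.le_idxOf hpref hprio hcap hσ hσu
    have hlt := List.idxOf_lt_length_iff.2 hw
    cases ht : I.target p u with
    | none =>
      rw [I.target_eq_none_iff] at ht
      omega
    | some w' =>
      have ht' := I.target_eq_some_iff.1 ht
      rcases hle.eq_or_lt with heq | hlt
      · left
        rw [← ht, I.target_eq_some_iff.2 ⟨hw, heq.symm⟩]
      · exact .inr ⟨ht'.1, hw, ht'.2 ▸ hlt⟩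

theorem Market.Terminal.isStable {I : Market n m} {p : Fin n → ℕ} (h : I.Terminal p) :
    I.IsStable (I.target p) := by
  have hcap : I.RespectsCap (I.target p) := by
    intro w
    by_contra! hlt
    -- the applicant ranked lowest by an overfull school is to be rejected
    set S := Finset.univ.filter fun u => I.target p u = some w with hS
    have hlt' : I.cap w < S.card := hlt
    obtain ⟨u, huS, hmax⟩ := S.exists_max_image (fun u => (I.prio w).idxOf u)
      (Finset.card_pos.1 (by omega))
    have hprio : ∀ v ∈ S, v ∈ I.prio w := fun v hv =>
      (I.mutual_acceptable v w).1 (I.target_eq_some_iff.1 (Finset.mem_filter.1 hv).2).1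
    refine h.2 u ⟨w, (Finset.mem_filter.1 huS).2, ?_⟩
    have hsub : S.erase u ⊆ I.rivals p u w := by
      intro v hv
      obtain ⟨hne, hvS⟩ := Finset.mem_erase.1 hv
      rw [I.mem_rivals]
      refine ⟨(Finset.mem_filter.1 hvS).2, hprio v hvS, hprio u huS,
        lt_of_le_of_ne (hmax v hvS) fun heq => hne ((List.idxOf_inj (hprio v hvS)).1 heq)⟩
    have := Finset.card_le_card hsub
    rw [Finset.card_erase_of_mem huS] at this
    omega
  refine ⟨fun u w hu => (I.target_eq_some_iff.1 hu).1, hcap, ?_⟩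
  rintro u w ⟨hu, hpr, hb⟩
  have hw := (I.mutual_acceptable u w).2 hu
  have hlt : (I.pref u).idxOf w < p u := by
    cases ht : I.target p u with
    | none => exact (List.idxOf_lt_length_iff.2 hw).trans_le (I.target_eq_none_iff.1 ht)
    | some w' =>
      rw [ht] at hpr
      exact (I.target_eq_some_iff.1 ht).2 ▸ hpr.2.2
  have hc := h.1.cap_le_card_rivals hw hlt
  have hsub : I.rivals p u w ⊆ Finset.univ.filter fun v => I.target p v = some w := fun v hv => by
    simpa using (I.mem_rivals.1 hv).1
  have hle := Finset.card_le_card hsub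
  have := hcap w
  unfold load at *
  rcases hb with hb | ⟨u', hu', hprec⟩
  · omega
  · have : (I.rivals p u w).card < (Finset.univ.filter fun v => I.target p v = some w).card := by
      refine Finset.card_lt_card ⟨hsub, fun hsup => ?_⟩
      have := (I.mem_rivals.1 (hsup (show u' ∈ _ by simpa using hu'))).2.2.2
      exact lt_asymm this hprec.2.2
    omega

theorem Market.Terminal.isStudentOptimal {I : Market n m} {p : Fin n → ℕ} (h : I.Terminal p) :
    I.IsStudentOptimal (I.target p) :=
  ⟨h.isStable, fun _ hσ => h.weaklyPrefers rfl rfl (fun _ => le_rfl) hσ⟩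

/-! ### Deferred acceptance in sweeps over all students -/

open Classical in
/-- Reject the student `j` if this is called for. -/
noncomputable def Market.advance (I : Market n m) (p : Fin n → ℕ) (j : ℕ) : Fin n → ℕ :=
  if h : j < n then
    if I.Rejects p ⟨j, h⟩ then Function.update p ⟨j, h⟩ (p ⟨j, h⟩ + 1) else p
  else p

/-- Go through the students `0, …, N - 1` once. -/
noncomputable def Market.sweep (I : Market n m) (p : Fin n → ℕ) : ℕ → Fin n → ℕ
  | 0 => p
  | j + 1 => I.advance (I.sweep p j) j

/-- The rejection counts after `j` sweeps over `N` students. -/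
noncomputable def Market.sweeps (I : Market n m) (N : ℕ) : ℕ → Fin n → ℕ
  | 0 => fun _ => 0
  | j + 1 => I.sweep (I.sweeps N j) N

theorem Market.Reachable.advance {I : Market n m} {p : Fin n → ℕ} (h : I.Reachable p) (j : ℕ) :
    I.Reachable (I.advance p j) := by
  unfold Market.advance
  split_ifs with h₁ h₂
  · exact .reject h h₂
  · exact h
  · exact h

theorem Market.Reachable.sweep {I : Market n m} {p : Fin n → ℕ} (h : I.Reachable p) (j : ℕ) :
    I.Reachable (I.sweep p j) := by
  induction j with
  | zero => exact h
  | succ j ih => exact ih.advance j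

theorem Market.reachable_sweeps (I : Market n m) (N j : ℕ) : I.Reachable (I.sweeps N j) := by
  induction j with
  | zero => exact .zero
  | succ j ih => exact ih.sweep N

theorem Market.le_advance (I : Market n m) (p : Fin n → ℕ) (j : ℕ) : p ≤ I.advance p j := by
  unfold Market.advance
  split_ifs with h₁ h₂
  · intro u
    by_cases hu : u = ⟨j, h₁⟩
    · subst hu
      simp
    · simp [hu]
  · exact le_rfl
  · exact le_rfl

theorem Market.sweep_mono (I : Market n m) (p : Fin n → ℕ) : Monotone (I.sweep p) :=
  monotone_nat_of_le_succ fun j => I.le_advance _ j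

theorem Market.not_rejects_of_sweep_eq (I : Market n m) {p : Fin n → ℕ} {N : ℕ} (hN : n ≤ N)
    (h : I.sweep p N = p) (u : Fin n) : ¬ I.Rejects p u := by
  intro hr
  have hconst : ∀ j ≤ N, I.sweep p j = p := fun j hj =>
    le_antisymm ((I.sweep_mono p hj).trans h.le) (I.sweep_mono p (Nat.zero_le j))
  have h₁ := hconst (u + 1) (by omega)
  rw [Market.sweep, hconst u (by omega), Market.advance, dif_pos u.2, if_pos hr] at h₁
  simpa using congrFun h₁ u

/-- As many sweeps as there are entries on all preference lists, and one more, are enough: each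
sweep before the last makes a rejection, and no student is rejected more often than its list is
long. -/
theorem Market.terminal_sweeps (I : Market n m) {N : ℕ} (hN : n ≤ N)
    (hS : ∑ u, (I.pref u).length < N) : I.Terminal (I.sweeps N N) := by
  refine ⟨I.reachable_sweeps N N, ?_⟩
  -- a sweep that changes something increases the total number of rejections
  have key : ∀ j, j ≤ ∑ u, I.sweeps N j u ∨ ∀ u, ¬ I.Rejects (I.sweeps N j) u := by
    intro j
    induction j with
    | zero => exact .inl (Nat.zero_le _)
    | succ j ih =>
      by_cases h : I.sweep (I.sweeps N j) N = I.sweeps N j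
      · right
        rw [Market.sweeps, h]
        exact I.not_rejects_of_sweep_eq hN h
      · have hle : I.sweeps N j ≤ I.sweep (I.sweeps N j) N := I.sweep_mono _ (Nat.zero_le N)
        rcases ih with ih | ih
        · left
          obtain ⟨hle', u, hu⟩ := Pi.lt_def.1 (lt_of_le_of_ne hle (Ne.symm h))
          have := Finset.sum_lt_sum (fun v _ => hle' v) ⟨u, Finset.mem_univ u, hu⟩
          exact lt_of_le_of_lt ih this
        · refine absurd ?_ h
          have : ∀ i, I.sweep (I.sweeps N j) i = I.sweeps N j := by
            intro i
            induction i with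
            | zero => rfl
            | succ i hi =>
              rw [Market.sweep, hi, Market.advance]
              split_ifs with h₁ h₂
              · exact absurd h₂ (ih _)
              · rfl
              · rfl
          exact this N
  rcases key N with h | h
  · have := Finset.sum_le_sum fun u (_ : u ∈ Finset.univ) =>
      (I.reachable_sweeps N N).le_length u
    omega
  · exact h

theorem Market.exists_terminal (I : Market n m) : ∃ p, I.Terminal p :=
  ⟨_, I.terminal_sweeps (N := n + ∑ u, (I.pref u).length + 1) (by omega) (by omega)⟩

/-! ### The uniform-increment algorithm -/

theorem Market.WeaklyPrefers.antisymm {I : Market n m} {u : Fin n} {a b : Option (Fin m)}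
    (hab : I.WeaklyPrefers u a b) (hba : I.WeaklyPrefers u b a) : a = b := by
  rcases hab with hab | hab
  · exact hab
  rcases hba with hba | hba
  · exact hba.symm
  cases a <;> cases b <;> simp only [Market.Prefers] at hab hba
  exact absurd hab.2.2 (lt_asymm hba.2.2)

theorem Market.IsStudentOptimal.unique {I : Market n m} {μ σ : Assignment n m}
    (hμ : I.IsStudentOptimal μ) (hσ : I.IsStudentOptimal σ) : μ = σ :=
  funext fun u => (hμ.2 σ hσ.1 u).antisymm (hσ.2 μ hμ.1 u)

theorem IsPerfect.of_weaklyPrefers {I : Market n m} {μ σ : Assignment n m} (hσ : IsPerfect σ)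
    (h : ∀ u, I.WeaklyPrefers u (μ u) (σ u)) : IsPerfect μ := by
  intro u hu
  rcases h u with h | h
  · exact hσ u (h ▸ hu)
  · rw [hu] at h
    exact h

/-- With `n` additional places everywhere, no school is full. -/
theorem Market.IsStable.isPerfect_of_le {I : Market n m} {r : Fin m → ℕ} (hr : ∀ w, n ≤ r w)
    {μ : Assignment n m} (hμ : (I.raise r).IsStable μ) : IsPerfect μ := by
  intro u hu
  obtain ⟨w, hw⟩ := List.exists_mem_of_ne_nil _ (I.pref_ne_nil u)
  refine hμ.2.2 u w ⟨(I.mutual_acceptable u w).1 hw, hu ▸ hw, .inl ?_⟩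
  have h₁ : load μ w ≤ n := (Finset.card_le_univ _).trans (by simp)
  have h₂ := I.cap_pos w
  have h₃ := hr w
  show load μ w < I.cap w + r w
  omega

/-- If deferred acceptance with `k` additional places everywhere is not perfect, then no vector with
entries at most `k` is feasible. -/
theorem Market.not_feasible_of_not_isPerfect {I : Market n m} {k : ℕ} {μ : Assignment n m}
    (hμ : (I.raise fun _ => k).IsStudentOptimal μ) (hn : ¬ IsPerfect μ) {r : Fin m → ℕ}
    (hr : maxNorm r ≤ k) : ¬ I.Feasible r := by
  rintro ⟨σ, hσ, hp⟩
  obtain ⟨p, h⟩ := (I.raise fun _ => k).exists_terminal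
  refine hn ?_
  rw [hμ.unique h.isStudentOptimal]
  exact hp.of_weaklyPrefers (h.weaklyPrefers (I := I.raise fun _ => k) (J := I.raise r) rfl rfl
    (fun w => Nat.add_le_add_left ((Finset.le_sup (Finset.mem_univ w)).trans hr) _) hσ)

theorem UniformLoop.exists_eq {I : Market n m} {r : Fin m → ℕ} {μ : Assignment n m}
    (h : UniformLoop I r μ) : ∃ k, (r = fun _ => k) ∧ (I.raise r).IsStudentOptimal μ ∧
      ∀ j < k, ∃ σ, (I.raise fun _ => j).IsStudentOptimal σ ∧ ¬ IsPerfect σ := by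
  induction h with
  | start h => exact ⟨0, rfl, h, fun j hj => absurd hj (Nat.not_lt_zero j)⟩
  | @next r μ μ' _ hn hμ' ih =>
    obtain ⟨k, rfl, hμ, hk⟩ := ih
    refine ⟨k + 1, rfl, hμ', fun j hj => ?_⟩
    rcases Nat.lt_succ_iff_lt_or_eq.1 hj with hj | rfl
    · exact hk j hj
    · exact ⟨μ, hμ, hn⟩

theorem uniformLoop_of_not_isPerfect {I : Market n m} {k : ℕ} {μ : Assignment n m}
    (hμ : (I.raise fun _ => k).IsStudentOptimal μ)
    (hk : ∀ j < k, ∃ σ, (I.raise fun _ => j).IsStudentOptimal σ ∧ ¬ IsPerfect σ) :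
    UniformLoop I (fun _ => k) μ := by
  induction k generalizing μ with
  | zero => exact .start hμ
  | succ k ih =>
    obtain ⟨σ, hσ, hn⟩ := hk k (Nat.lt_succ_self k)
    exact .next (ih hσ fun j hj => hk j (hj.trans (Nat.lt_succ_self k))) hn hμ

/-- An unmatched student exists only if there are schools; so the maximum of the constant vector `k`
is `k`, even if there is no school. -/
theorem maxNorm_const {I : Market n m} {k : ℕ}
    (hk : ∀ j < k, ∃ σ, (I.raise fun _ => j).IsStudentOptimal σ ∧ ¬ IsPerfect σ) :
    maxNorm (fun _ : Fin m => k) = k := by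
  rcases Nat.eq_zero_or_pos k with rfl | hpos
  · exact Nat.le_zero.1 (Finset.sup_le fun _ _ => le_rfl)
  · obtain ⟨σ, -, hn⟩ := hk 0 hpos
    obtain ⟨u, -⟩ := not_forall.1 hn
    obtain ⟨w, -⟩ := List.exists_mem_of_ne_nil _ (I.pref_ne_nil u)
    exact le_antisymm (Finset.sup_le fun _ _ => le_rfl)
      (Finset.le_sup (f := fun _ : Fin m => k) (Finset.mem_univ w))

theorem UniformReturns.isBestSolution {I : Market n m} {r : Fin m → ℕ} {μ : Assignment n m}
    (h : UniformReturns I r μ) : I.IsBestSolution r μ := by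
  obtain ⟨hl, hp⟩ := h
  obtain ⟨k, rfl, hμ, hk⟩ := hl.exists_eq
  have hmax := maxNorm_const hk
  refine ⟨⟨⟨μ, hμ.1, hp⟩, fun r' hr' => ?_⟩, hμ, hp, fun r' hr' σ hσ u => ?_⟩
  · by_contra! hlt
    obtain ⟨σ, hσ, hn⟩ := hk (maxNorm r') (hlt.trans_le hmax.le)
    exact Market.not_feasible_of_not_isPerfect hσ hn le_rfl hr'
  · obtain ⟨p, h⟩ := (I.raise fun _ => k).exists_terminal
    rw [hμ.unique h.isStudentOptimal]
    exact h.weaklyPrefers (I := I.raise fun _ => k) (J := I.raise r') rfl rfl (fun w => Nat.add_le_add_left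
      ((Finset.le_sup (Finset.mem_univ w)).trans (hr'.trans hmax.le)) _) hσ u

theorem exists_uniformReturns (I : Market n m) : ∃ r μ, UniformReturns I r μ := by
  classical
  choose p hp using fun k : ℕ => (I.raise fun _ => k).exists_terminal
  have hex : ∃ k, IsPerfect ((I.raise fun _ => k).target (p k)) :=
    ⟨n, (hp n).isStable.isPerfect_of_le fun _ => le_rfl⟩
  exact ⟨_, _, uniformLoop_of_not_isPerfect (hp (Nat.find hex)).isStudentOptimal
    fun j hj => ⟨_, (hp j).isStudentOptimal, Nat.find_min hex hj⟩, Nat.find_spec hex⟩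

theorem UniformReturns.minMaxSP_iff {I : Market n m} {r : Fin m → ℕ} {μ : Assignment n m}
    (h : UniformReturns I r μ) (k : ℕ) : I.MinMaxSP k ↔ maxNorm r ≤ k := by
  have hopt := h.isBestSolution.1
  exact ⟨fun ⟨r', hr', hf⟩ => (hopt.2 r' hf).trans hr', fun hr => ⟨r, hr, hopt.1⟩⟩

/-! ### Reading the encoding of an instance -/

/-- The address of the `i`-th of the lists that are stored in `M` from the address `a` on, each of
them preceded by its length. -/
def offset (M : ℕ → ℕ) (a : ℕ) : ℕ → ℕ
  | 0 => a
  | i + 1 => offset M a i + M (offset M a i) + 1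

theorem offset_succ' (M : ℕ → ℕ) (a i : ℕ) :
    offset M a (i + 1) = offset M (a + M a + 1) i := by
  induction i with
  | zero => rfl
  | succ i ih => rw [offset, ih, offset]

/-- Below, `hd` is what precedes the lists in `x`, and `T` is the list of these lists. -/
theorem offset_spec (T : List (List ℕ)) (hd : List ℕ) {x : List ℕ}
    (hx : x = hd ++ (T.map fun l => l.length :: l).flatten) {M : ℕ → ℕ}
    (hM : ∀ i, M i = x.getD i 0) {i : ℕ} (hi : i < T.length) :
    M (offset M hd.length i) = T[i].length ∧
      (∀ j (hj : j < T[i].length), M (offset M hd.length i + 1 + j) = T[i][j]) ∧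
      offset M hd.length i + T[i].length < x.length := by
  induction T generalizing hd i with
  | nil => simp at hi
  | cons l T ih =>
    have h₀ : M hd.length = l.length := by
      rw [hM, hx]
      simp
    cases i with
    | zero =>
      refine ⟨h₀, fun j hj => ?_, ?_⟩
      · have hj' : j < l.length := hj
        rw [offset, hM, hx, List.getD_eq_getElem?_getD, List.getElem?_append_right (by omega),
          show hd.length + 1 + j - hd.length = j + 1 by omega]
        simp only [List.map_cons, List.flatten_cons, List.cons_append, List.getElem?_cons_succ]
        rw [List.getElem?_append_left hj', List.getElem?_eq_getElem hj']
        rfl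
      · simp only [offset, hx, List.map_cons, List.flatten_cons, List.length_append,
          List.length_cons, List.getElem_cons_zero]
        omega
    | succ i =>
      have := ih (hd ++ l.length :: l) (by simp [hx]) (i := i) (by simpa using hi)
      rw [List.length_append, List.length_cons, ← add_assoc] at this
      rw [offset_succ', h₀]
      simpa using this

/-- The memory `M` holds the instance from the address `b` on, and an input of length `L` ends
behind it. -/
structure Market.EncodedIn (I : Market n m) (b L : ℕ) (M : ℕ → ℕ) : Prop where
  students : M b = n
  schools : M (b + 1) = m
  capacity (w : Fin m) : M (b + 2 + w) = I.cap w
  pref_length (u : Fin n) : M (offset M (b + 2 + m) u) = (I.pref u).length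
  pref_get (u : Fin n) (j : ℕ) (hj : j < (I.pref u).length) :
    M (offset M (b + 2 + m) u + 1 + j) = (I.pref u)[j]
  pref_lt (u : Fin n) : offset M (b + 2 + m) u + (I.pref u).length < L
  prio_length (w : Fin m) : M (offset M (b + 2 + m) (n + w)) = (I.prio w).length
  prio_get (w : Fin m) (j : ℕ) (hj : j < (I.prio w).length) :
    M (offset M (b + 2 + m) (n + w) + 1 + j) = (I.prio w)[j]
  prio_lt (w : Fin m) : offset M (b + 2 + m) (n + w) + (I.prio w).length < L
  header_lt : b + 2 + m ≤ L
  students_lt : n < L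
  lists_le : n + m ≤ L
  sum_lt : ∑ u, (I.pref u).length < L

theorem encodeList_eq {k : ℕ} (l : List (Fin k)) :
    encodeList l = l.length :: l.map fun i : Fin k => (i : ℕ) := by
  simp [encodeList, List.map_eq_flatMap]

theorem Instance.encodedIn (I : Instance) (hd : List ℕ) :
    I.market.EncodedIn hd.length (hd ++ I.encode).length fun i => (hd ++ I.encode).getD i 0 := by
  set x := hd ++ I.encode with hx
  set M : ℕ → ℕ := fun i => x.getD i 0 with hM
  set T₁ : List (List ℕ) := List.ofFn fun u : Fin I.n => (I.market.pref u).map fun i : Fin I.m => (i : ℕ) with hT₁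
  set T₂ : List (List ℕ) := List.ofFn fun w : Fin I.m => (I.market.prio w).map fun i : Fin I.n => (i : ℕ) with hT₂
  set hd' := hd ++ (I.n :: I.m :: List.ofFn I.market.cap) with hhd'
  have hx' : x = hd' ++ ((T₁ ++ T₂).map fun l => l.length :: l).flatten := by
    simp [hx, hhd', Instance.encode, hT₁, hT₂, List.map_ofFn, Function.comp_def, encodeList_eq]
  have hlen : hd'.length = hd.length + 2 + I.m := by
    simp [hhd']
    omega
  have hxlen : x.length = hd'.length + ∑ u, ((I.market.pref u).length + 1) +
      ∑ w, ((I.market.prio w).length + 1) := by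
    rw [hx']
    simp [hT₁, hT₂, List.map_ofFn, Function.comp_def, List.length_flatten, List.sum_ofFn]
    omega
  have hget : ∀ i, hd.length ≤ i → i < hd'.length →
      M i = (I.n :: I.m :: List.ofFn I.market.cap).getD (i - hd.length) 0 := by
    intro i h₁ h₂
    simp only [hM, hx', List.getD_eq_getElem?_getD]
    rw [List.getElem?_append_left h₂, hhd', List.getElem?_append_right h₁]
  have hspec := fun i (hi : i < (T₁ ++ T₂).length) => offset_spec (T₁ ++ T₂) hd' hx'
    (M := M) (fun _ => rfl) hi
  rw [hlen] at hspec
  have h₁ : ∀ u : Fin I.n, ∃ h : (u : ℕ) < (T₁ ++ T₂).length,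
      (T₁ ++ T₂)[(u : ℕ)] = (I.market.pref u).map fun i : Fin I.m => (i : ℕ) := fun u =>
    ⟨by simp [hT₁]; omega, by
      rw [List.getElem_append_left (by simp [hT₁])]
      simp [hT₁]⟩
  have h₂ : ∀ w : Fin I.m, ∃ h : I.n + (w : ℕ) < (T₁ ++ T₂).length,
      (T₁ ++ T₂)[I.n + (w : ℕ)] = (I.market.prio w).map fun i : Fin I.n => (i : ℕ) := fun w =>
    ⟨by simp [hT₁, hT₂], by
      rw [List.getElem_append_right (by simp [hT₁])]
      simp [hT₁, hT₂]⟩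
  simp only [Finset.sum_add_distrib, Finset.sum_const, Finset.card_univ, Fintype.card_fin,
    smul_eq_mul, mul_one] at hxlen
  constructor
  · rw [hget _ le_rfl (by omega)]
    simp
  · rw [hget _ (by omega) (by omega)]
    simp
  · intro w
    have := w.2
    rw [hget _ (by omega) (by omega), show hd.length + 2 + w - hd.length = w + 1 + 1 by omega]
    simp
  · intro u
    obtain ⟨h, hT⟩ := h₁ u
    rw [(hspec u h).1, hT, List.length_map]
  · intro u j hj
    obtain ⟨h, hT⟩ := h₁ u
    rw [(hspec u h).2.1 j (by rw [hT]; simpa using hj)]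
    simp [hT]
  · intro u
    obtain ⟨h, hT⟩ := h₁ u
    simpa [hT] using (hspec u h).2.2
  · intro w
    obtain ⟨h, hT⟩ := h₂ w
    rw [(hspec _ h).1, hT, List.length_map]
  · intro w j hj
    obtain ⟨h, hT⟩ := h₂ w
    rw [(hspec _ h).2.1 j (by rw [hT]; simpa using hj)]
    simp [hT]
  · intro w
    obtain ⟨h, hT⟩ := h₂ w
    simpa [hT] using (hspec _ h).2.2
  · omega
  · omega
  · omega
  · omega

/-! ### The expressions of the algorithm -/

namespace Program

open RAM

/-- The length of the list with number `a`. The address of that list is kept in cell `L + a`; the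
preference lists come first, then the priority orders. Here and below the variable `0` holds `L`,
and `1` and `2` hold the numbers of students and of schools. -/
def listLength (a : Expr) : Expr := .mem (.mem (.add (.var 0) a))

/-- The entry at position `j` of the list with number `a`. -/
def listGet (a j : Expr) : Expr := .mem (.add (.add (.mem (.add (.var 0) a)) (.const 1)) j)

/-- The rejection count of student `a`. -/
def count (a : Expr) : Expr := .mem (.add (.add (.var 0) (.var 0)) a)

/-- The code of the school to which student `a` applies. -/
def target (a : Expr) : Expr :=
  .ite (.sub (listLength a) (count a)) (.add (listGet a (count a)) (.const 1)) (.const 0)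

/-- Zero if and only if `a` and `b` are equal. -/
def distance (a b : Expr) : Expr := .add (.sub a b) (.sub b a)

/-- The rank of the student in variable `x` on the priority order of the school with the code in
variable `9`, as the sum of all positions where this student occurs. -/
def rank (x : ℕ) : Expr :=
  .sum 11 (.ite (.sub (listLength (.add (.var 1) (.sub (.var 9) (.const 1)))) (.var 11))
    (.ite (distance (listGet (.add (.var 1) (.sub (.var 9) (.const 1))) (.var 11)) (.var x))
      (.const 0) (.var 11)) (.const 0))

/-- The number of rivals of the student in variable `8` at the school with the code in variable
`9`. -/
def rivals : Expr :=
  .sum 10 (.ite (.sub (.var 1) (.var 10))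
    (.ite (distance (target (.var 10)) (.var 9)) (.const 0)
      (.ite (.sub (rank 8) (rank 10)) (.const 1) (.const 0))) (.const 0))

/-- The number of students without a school to apply to. -/
def unmatched : Expr :=
  .sum 10 (.ite (.sub (.var 1) (.var 10)) (.ite (target (.var 10)) (.const 0) (.const 1))
    (.const 0))

end Program

open RAM

/-! ### Values of the expressions -/

/-- The machine holds the instance `I`, encoded from the address `b` on, and the table of the
addresses of its lists. -/
structure Layout (I : Market n m) (b L : ℕ) (M : ℕ → ℕ) (s : State) : Prop where
  enc : I.EncodedIn b L M
  bound : s.reg 0 = L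
  students : s.reg 1 = n
  schools : s.reg 2 = m
  input : ∀ i < L, s.mem i = M i
  table : ∀ i < n + m, s.mem (L + i) = offset M (b + 2 + m) i

/-- The machine holds the rejection counts `p`. -/
def HoldsCounts (L : ℕ) (p : Fin n → ℕ) (s : State) : Prop := ∀ u : Fin n, s.mem (L + L + u) = p u

theorem HoldsCounts.setReg {L : ℕ} {p : Fin n → ℕ} {s : State} (h : HoldsCounts L p s)
    (x v : ℕ) : HoldsCounts L p (s.setReg x v) := h

namespace Layout

variable {I : Market n m} {b L : ℕ} {M : ℕ → ℕ} {s : State}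

theorem setReg (h : Layout I b L M s) {x : ℕ} (hx : 3 ≤ x) (v : ℕ) :
    Layout I b L M (s.setReg x v) :=
  ⟨h.enc, by rw [State.setReg_reg_of_ne _ _ (by omega), h.bound],
    by rw [State.setReg_reg_of_ne _ _ (by omega), h.students],
    by rw [State.setReg_reg_of_ne _ _ (by omega), h.schools], h.input, h.table⟩

theorem setMem (h : Layout I b L M s) {i : ℕ} (hi : L + L ≤ i) (v : ℕ) :
    Layout I b L M (s.setMem i v) := by
  have := h.enc.lists_le
  have := h.enc.students_lt
  refine ⟨h.enc, h.bound, h.students, h.schools, fun j hj => ?_, fun j hj => ?_⟩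
  · rw [← h.input j hj]
    exact Function.update_of_ne (by omega) _ _
  · rw [← h.table j hj]
    exact Function.update_of_ne (by omega) _ _

theorem eval_listLength_pref (h : Layout I b L M s) {a : Expr} {u : Fin n}
    (ha : a.eval L s = u) : (Program.listLength a).eval L s = (I.pref u).length := by
  have := h.enc.pref_lt u
  simp only [Program.listLength, Expr.eval, h.bound, ha]
  rw [h.table _ (by omega), h.input _ (by omega), h.enc.pref_length]

theorem eval_listGet_pref (h : Layout I b L M s) {a e : Expr} {u : Fin n} {j : ℕ}
    (ha : a.eval L s = u) (he : e.eval L s = j) (hj : j < (I.pref u).length) :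
    (Program.listGet a e).eval L s = (I.pref u)[j] := by
  have := h.enc.pref_lt u
  simp only [Program.listGet, Expr.eval, h.bound, ha, he]
  rw [h.table _ (by omega), h.input _ (by omega), h.enc.pref_get u j hj]

theorem eval_listLength_prio (h : Layout I b L M s) {a : Expr} {w : Fin m}
    (ha : a.eval L s = n + w) : (Program.listLength a).eval L s = (I.prio w).length := by
  have := h.enc.prio_lt w
  simp only [Program.listLength, Expr.eval, h.bound, ha]
  rw [h.table _ (by omega), h.input _ (by omega), h.enc.prio_length]

theorem eval_listGet_prio (h : Layout I b L M s) {a e : Expr} {w : Fin m} {j : ℕ}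
    (ha : a.eval L s = n + w) (he : e.eval L s = j) (hj : j < (I.prio w).length) :
    (Program.listGet a e).eval L s = (I.prio w)[j] := by
  have := h.enc.prio_lt w
  simp only [Program.listGet, Expr.eval, h.bound, ha, he]
  rw [h.table _ (by omega), h.input _ (by omega), h.enc.prio_get w j hj]

theorem eval_count (h : Layout I b L M s) {p : Fin n → ℕ} (hp : HoldsCounts L p s) {a : Expr}
    {u : Fin n} (ha : a.eval L s = u) : (Program.count a).eval L s = p u := by
  simp only [Program.count, Expr.eval, h.bound, ha]
  exact hp u

theorem eval_target (h : Layout I b L M s) {p : Fin n → ℕ} (hp : HoldsCounts L p s) {a : Expr}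
    {u : Fin n} (ha : a.eval L s = u) :
    (Program.target a).eval L s = encodeOutcome (I.target p u) := by
  have h₁ := h.eval_listLength_pref ha
  have h₂ := h.eval_count hp ha
  simp only [Program.target, Expr.eval, h₁, h₂, Market.target]
  by_cases hl : p u < (I.pref u).length
  · rw [if_pos (by omega), h.eval_listGet_pref ha h₂ hl, List.getElem?_eq_getElem hl]
    rfl
  · rw [if_neg (by omega), List.getElem?_eq_none (by omega)]
    rfl

end Layout

theorem sum_range_eq_sum_fin {k L : ℕ} (hk : k ≤ L) {g : ℕ → ℕ} {f : Fin k → ℕ}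
    (h₁ : ∀ i : Fin k, g i = f i) (h₂ : ∀ j, k ≤ j → g j = 0) :
    ∑ j ∈ Finset.range L, g j = ∑ i, f i := by
  rw [← Finset.sum_congr rfl fun i _ => h₁ i, ← Finset.sum_range]
  refine (Finset.sum_subset (Finset.range_mono hk) fun j _ hj => h₂ j ?_).symm
  simpa using hj

namespace Layout

variable {I : Market n m} {b L : ℕ} {M : ℕ → ℕ} {s : State}

theorem eval_distance_ne_zero_iff {a e : Expr} :
    (Program.distance a e).eval L s ≠ 0 ↔ a.eval L s ≠ e.eval L s := by
  simp only [Program.distance, Expr.eval]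
  omega

theorem eval_rank (h : Layout I b L M s) {x : ℕ} (hx : x ≠ 11) {v : Fin n} {w : Fin m}
    (hs : s.reg x = v) (hw : s.reg 9 = w + 1) (hv : v ∈ I.prio w) :
    (Program.rank x).eval L s = (I.prio w).idxOf v := by
  have hlt := h.enc.prio_lt w
  have hidx := List.idxOf_lt_length_iff.2 hv
  have ha : ∀ j, (Expr.add (.var 1) (.sub (.var 9) (.const 1))).eval L (s.setReg 11 j) = n + w := by
    intro j
    simp [Expr.eval, State.setReg, h.students, hw]
  have hlen := fun j => (h.setReg (x := 11) (by omega) j).eval_listLength_prio (ha j)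
  have hvar : ∀ j, (Expr.var 11).eval L (s.setReg 11 j) = j := fun j => by
    simp [Expr.eval, State.setReg]
  have hx' : ∀ j, (Expr.var x).eval L (s.setReg 11 j) = v := fun j => by
    simp [Expr.eval, State.setReg, hx, hs]
  rw [Program.rank, Expr.eval,
    sum_range_eq_sum_fin (k := (I.prio w).length) (by omega)
      (f := fun i => if (I.prio w)[i] = v then (i : ℕ) else 0) (fun i => ?_) fun j hj => ?_]
  · rw [Finset.sum_eq_single ⟨_, hidx⟩]
    · simp
    · intro i _ hi
      refine if_neg fun heq => hi (Fin.ext ?_)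
      rw [← (I.prio_nodup w).idxOf_getElem _ i.2]
      exact congrArg (fun v => (I.prio w).idxOf v) heq
    · simp
  · have hget := (h.setReg (x := 11) (by omega) i).eval_listGet_prio (ha i) (hvar i) i.2
    have hd := eval_distance_ne_zero_iff (L := L) (s := s.setReg 11 i)
      (a := Program.listGet (.add (.var 1) (.sub (.var 9) (.const 1))) (.var 11)) (e := .var x)
    rw [hget, hx'] at hd
    rw [Expr.eval, if_pos (by rw [Expr.eval, hlen, hvar]; omega), Expr.eval, hvar]
    by_cases heq : (I.prio w)[i] = v
    · rw [if_neg (fun hne => hd.1 hne (congrArg Fin.val heq)), if_pos heq]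
    · rw [if_pos (hd.2 fun hne => heq (Fin.ext hne)), if_neg heq]
      rfl
  · rw [Expr.eval, if_neg (by rw [Expr.eval, hlen, hvar]; omega)]
    rfl

theorem encodeOutcome_eq_succ_iff {o : Option (Fin m)} {w : Fin m} :
    encodeOutcome o = w + 1 ↔ o = some w := by
  cases o with
  | none => simp [encodeOutcome]
  | some w' => simp [encodeOutcome, Fin.ext_iff]

theorem eval_rivals (h : Layout I b L M s) {p : Fin n → ℕ} (hp : HoldsCounts L p s) {u : Fin n}
    {w : Fin m} (hu : s.reg 8 = u) (hw : s.reg 9 = w + 1) (hpu : I.target p u = some w) :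
    Program.rivals.eval L s = (I.rivals p u w).card := by
  have hlt := h.enc.students_lt
  have h' := fun j => h.setReg (x := 10) (by omega) j
  have hu' : ∀ j, (s.setReg 10 j).reg 8 = u := fun j => by simp [State.setReg, hu]
  have hw' : ∀ j, (s.setReg 10 j).reg 9 = w + 1 := fun j => by simp [State.setReg, hw]
  have hprio : ∀ v, I.target p v = some w → v ∈ I.prio w := fun v hv =>
    (I.mutual_acceptable v w).1 (I.target_eq_some_iff.1 hv).1
  rw [Program.rivals, Expr.eval, Market.rivals, Finset.card_filter,
    sum_range_eq_sum_fin (k := n) hlt.le (fun v => ?_) fun j hj => ?_]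
  · have hv : (s.setReg 10 v).reg 10 = v := State.setReg_reg_self _ _ _
    have hd := eval_distance_ne_zero_iff (L := L) (s := s.setReg 10 v)
      (a := Program.target (.var 10)) (e := .var 9)
    rw [(h' v).eval_target (hp.setReg _ _) (a := .var 10) hv, Expr.eval, hw', ne_eq (encodeOutcome _),
      encodeOutcome_eq_succ_iff] at hd
    rw [Expr.eval, if_pos (by simp [Expr.eval, State.setReg, h.students]; omega), Expr.eval]
    by_cases ht : I.target p v = some w
    · rw [if_neg (fun hne => hd.1 hne ht), Expr.eval, show ∀ a e : Expr, (Expr.sub a e).eval L (s.setReg 10 v) =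
          a.eval L (s.setReg 10 v) - e.eval L (s.setReg 10 v) from fun _ _ => rfl,
        (h' v).eval_rank (by omega) (hu' v) (hw' v) (hprio u hpu),
        (h' v).eval_rank (by omega) hv (hw' v) (hprio v ht)]
      simp only [Expr.eval]
      refine if_congr ?_ rfl rfl
      simp only [ht, Precedes, hprio u hpu, hprio v ht, true_and]
      omega
    · rw [if_pos (hd.2 ht), if_neg fun hand => ht hand.1]
      rfl
  · rw [Expr.eval, if_neg (by simp [Expr.eval, State.setReg, h.students, hj])]
    rfl

theorem eval_unmatched_eq_zero_iff (h : Layout I b L M s) {p : Fin n → ℕ}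
    (hp : HoldsCounts L p s) :
    Program.unmatched.eval L s = 0 ↔ IsPerfect (I.target p) := by
  have hlt := h.enc.students_lt
  have key : ∀ v : Fin n, (Expr.ite (.sub (.var 1) (.var 10))
      (.ite (Program.target (.var 10)) (.const 0) (.const 1)) (.const 0)).eval L (s.setReg 10 v) =
      if I.target p v = none then 1 else 0 := by
    intro v
    have ht := (h.setReg (x := 10) (by omega) v).eval_target (hp.setReg _ _) (a := .var 10)
      (u := v) (State.setReg_reg_self _ _ _)
    rw [Expr.eval, if_pos (by simp [Expr.eval, State.setReg, h.students]; omega), Expr.eval, ht]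
    cases I.target p v <;> simp [encodeOutcome, Expr.eval]
  rw [Program.unmatched, Expr.eval, sum_range_eq_sum_fin (k := n) hlt.le key fun j hj => ?_]
  · simp [IsPerfect]
  · rw [Expr.eval, if_neg (by simp [Expr.eval, State.setReg, h.students, hj])]
    rfl

end Layout

/-! ### The commands of the algorithm -/

namespace Program

open RAM

/-- Read the numbers of students and of schools, and build the table of the addresses of all lists;
the instance is encoded from the address `b` on. -/
def setup (b : ℕ) : Cmd :=
  .seq (.assign 1 (.mem (.const b))) <| .seq (.assign 2 (.mem (.const (b + 1)))) <|
    .seq (.assign 3 (.add (.const (b + 2)) (.var 2))) <|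
    .rep 6 <| .seq (.store (.add (.var 0) (.var 6)) (.var 3)) <|
      .assign 3 (.add (.add (.var 3) (.mem (.var 3))) (.const 1))

/-- Set all rejection counts to zero. -/
def reset : Cmd := .rep 8 (.store (.add (.add (.var 0) (.var 0)) (.var 8)) (.const 0))

/-- The code of the school to which the student in variable `8` applies, if this number belongs to
a student. -/
def applied : Expr := .ite (.sub (.var 1) (.var 8)) (target (.var 8)) (.const 0)

/-- Nonzero if and only if the student in variable `8` has to be rejected by the school with the
code in variable `9`; variable `4` holds the number of additional places at every school. -/
def rejected (b : ℕ) : Expr :=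
  .ite (.var 9) (.sub (.add rivals (.const 1))
    (.add (.mem (.add (.const (b + 2)) (.sub (.var 9) (.const 1)))) (.var 4))) (.const 0)

/-- Reject the student in variable `8` if this is called for. -/
def reject (b : ℕ) : Cmd :=
  .seq (.assign 9 applied) <| .cond (rejected b) <|
    .store (.add (.add (.var 0) (.var 0)) (.var 8)) (.add (count (.var 8)) (.const 1))

/-- Deferred acceptance for the number of additional places in variable `4`. -/
def deferredAcceptance (b : ℕ) : Cmd := .seq reset (.rep 7 (.rep 8 (reject b)))

/-- Increase the number of additional places, in variable `4`, until all students are matched;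
variable `5` tells whether they are. -/
def uniformIncrement (b : ℕ) : Cmd :=
  .rep 6 <| .cond (.sub (.const 1) (.var 5)) <| .seq (.assign 4 (.var 6)) <|
    .seq (deferredAcceptance b) <| .cond (.sub (.const 1) unmatched) (.assign 5 (.const 1))

/-- Write the solution, first the outcomes to cells that are not in use, then the whole output. -/
def writeSolution : Cmd :=
  .seq (.rep 8 (.store (.add (.add (.add (.var 0) (.var 0)) (.var 0)) (.var 8))
    (target (.var 8)))) <|
  .seq (.store (.const 0) (.var 4)) <|
  .seq (.rep 8 (.store (.add (.const 1) (.var 8)) (.var 4))) <|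
  .seq (.rep 8 (.store (.add (.add (.const 1) (.var 2)) (.var 8))
    (.mem (.add (.add (.add (.var 0) (.var 0)) (.var 0)) (.var 8))))) <|
  .assign 0 (.add (.add (.const 1) (.var 2)) (.var 1))

/-- Compare the number of additional places with the bound in cell `0`. -/
def writeDecision : Cmd :=
  .seq (.store (.const 0) (.ite (.sub (.var 4) (.mem (.const 0))) (.const 0) (.const 1))) <|
  .assign 0 (.const 1)

/-- Compute the solution of the uniform-increment algorithm for an encoded instance. -/
def solve : Cmd :=
  .seq (setup 0) (.seq (uniformIncrement 0) writeSolution)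

/-- Decide `MinMaxSP` for an encoded query, in which the bound precedes the instance. -/
def decideMinMaxSP : Cmd :=
  .seq (setup 1) (.seq (uniformIncrement 1) writeDecision)

end Program

open RAM

/-! ### Correctness of the commands -/

theorem iter_induction {f : State → State} {i L : ℕ} {s : State} (J : ℕ → State → Prop)
    (h₀ : J 0 s) (h : ∀ j < L, ∀ τ, J j τ → J (j + 1) (f (τ.setReg i j))) : J L (iter f i s L) := by
  suffices H : ∀ j ≤ L, J j (iter f i s j) from H L le_rfl
  intro j
  induction j with
  | zero => exact fun _ => h₀
  | succ j ih => exact fun hj => h j hj _ (ih (by omega))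

theorem setMem_mem_self (s : State) (i v : ℕ) : (s.setMem i v).mem i = v := by
  simp [State.setMem]

theorem setMem_mem_of_ne (s : State) {i j : ℕ} (v : ℕ) (h : j ≠ i) :
    (s.setMem i v).mem j = s.mem j := by
  simp [State.setMem, h]

theorem setReg_mem (s : State) (i v : ℕ) : (s.setReg i v).mem = s.mem := rfl

/-- The entries of the table behind the last list are meaningless, as the loop makes `L` rounds in
every case; they are never used. -/
theorem layout_setup {I : Market n m} {b L : ℕ} {s : State} (h : I.EncodedIn b L s.mem)
    (hs : s.reg 0 = L) : Layout I b L s.mem ((Program.setup b).run L s) ∧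
      ((Program.setup b).run L s).reg 5 = s.reg 5 := by
  set M := s.mem
  have hM := h.students
  have hM' := h.schools
  let J : ℕ → State → Prop := fun j τ => τ.reg 0 = L ∧ τ.reg 1 = n ∧ τ.reg 2 = m ∧
    (∀ i < L, τ.mem i = M i) ∧ (∀ i < j, i < n + m → τ.mem (L + i) = offset M (b + 2 + m) i) ∧
    (j ≤ n + m → τ.reg 3 = offset M (b + 2 + m) j) ∧ τ.reg 5 = s.reg 5
  have hlt : ∀ j < n + m, offset M (b + 2 + m) j < L := by
    intro j hj
    by_cases hjn : j < n
    · have := h.pref_lt ⟨j, hjn⟩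
      dsimp only at this
      omega
    · have := h.prio_lt ⟨j - n, by omega⟩
      dsimp only at this
      rw [show n + (j - n) = j by omega] at this
      omega
  have key : J L ((Program.setup b).run L s) := by
    refine iter_induction J ?_ ?_
    · refine ⟨?_, ?_, ?_, fun _ _ => rfl, fun i hi => absurd hi (Nat.not_lt_zero i),
        fun _ => ?_, ?_⟩
      · simp [Cmd.run, State.setReg, hs]
      · simp [Cmd.run, State.setReg, Expr.eval, M, hM]
      · simp [Cmd.run, State.setReg, Expr.eval, M, hM']
      · simp [Cmd.run, State.setReg, Expr.eval, M, hM', offset]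
      · simp [Cmd.run, State.setReg]
    · rintro j hj τ ⟨r₀, r₁, r₂, hmem, htab, r₃, r₅⟩
      simp only [Cmd.run, Expr.eval]
      have e₀ : (τ.setReg 6 j).reg 0 = L := (State.setReg_reg_of_ne _ _ (by omega)).trans r₀
      have e₆ : (τ.setReg 6 j).reg 6 = j := State.setReg_reg_self _ _ _
      rw [e₀, e₆]
      refine ⟨?_, ?_, ?_, fun i hi => ?_, fun i hi hi' => ?_, fun hj' => ?_, ?_⟩
      · simpa [State.setReg, State.setMem] using r₀
      · simpa [State.setReg, State.setMem] using r₁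
      · simpa [State.setReg, State.setMem] using r₂
      · rw [setReg_mem, setMem_mem_of_ne _ _ (by omega)]
        exact hmem i hi
      · rw [setReg_mem]
        by_cases hij : i = j
        · subst hij
          rw [setMem_mem_self, State.setReg_reg_of_ne _ _ (by omega)]
          exact r₃ hi'.le
        · rw [setMem_mem_of_ne _ _ (by omega)]
          exact htab i (by omega) hi'
      · have hr := r₃ (by omega)
        rw [State.setReg_reg_self, State.setMem_reg, State.setReg_reg_of_ne _ _ (by omega), hr,
          setMem_mem_of_ne _ _ (by have := hlt j (by omega); omega), setReg_mem,
          hmem _ (hlt j (by omega)), offset]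
      · simpa [State.setReg, State.setMem] using r₅
  obtain ⟨r₀, r₁, r₂, hmem, htab, -, r₅⟩ := key
  exact ⟨⟨h, r₀, r₁, r₂, hmem, fun i hi => htab i (by have := h.lists_le; omega) hi⟩, r₅⟩

namespace Layout

variable {I : Market n m} {b L : ℕ} {M : ℕ → ℕ} {s : State}

theorem reset (h : Layout I b L M s) :
    Layout I b L M (Program.reset.run L s) ∧
      HoldsCounts L (fun _ : Fin n => 0) (Program.reset.run L s) ∧
      ∀ x ≤ 7, (Program.reset.run L s).reg x = s.reg x := by
  have key := iter_induction (f := (Cmd.store (.add (.add (.var 0) (.var 0)) (.var 8))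
    (.const 0)).run L) (i := 8) (L := L) (s := s)
    (fun j τ => Layout I b L M τ ∧ (∀ i < j, τ.mem (L + L + i) = 0) ∧ ∀ x ≤ 7, τ.reg x = s.reg x)
    ⟨h, fun i hi => absurd hi (Nat.not_lt_zero i), fun _ _ => rfl⟩ (by
      rintro j hj τ ⟨h₁, h₂, h₃⟩
      have e₀ : (τ.setReg 8 j).reg 0 = L := (State.setReg_reg_of_ne _ _ (by omega)).trans h₁.bound
      have e₈ : (τ.setReg 8 j).reg 8 = j := State.setReg_reg_self _ _ _
      simp only [Cmd.run, Expr.eval, e₀, e₈]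
      refine ⟨(h₁.setReg (by omega) _).setMem (by omega) _, fun i hi => ?_, fun x hx => ?_⟩
      · by_cases hij : i = j
        · rw [hij, setMem_mem_self]
        · rw [setMem_mem_of_ne _ _ (by omega)]
          exact h₂ i (by omega)
      · rw [State.setMem_reg, State.setReg_reg_of_ne _ _ (by omega), h₃ x hx])
  exact ⟨key.1, fun u => key.2.1 u (u.2.trans h.enc.students_lt), key.2.2⟩

theorem eval_applied (h : Layout I b L M s) {p : Fin n → ℕ} (hp : HoldsCounts L p s) {j : ℕ}
    (hj : s.reg 8 = j) : Program.applied.eval L s =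
      if hjn : j < n then encodeOutcome (I.target p ⟨j, hjn⟩) else 0 := by
  have hv : (Expr.var 8).eval L s = j := hj
  have hn : (Expr.sub (.var 1) (.var 8)).eval L s = n - j := by
    simp only [Expr.eval, h.students, hj]
  rw [Program.applied, Expr.eval, hn]
  split_ifs with h₁ h₂ h₃
  · exact h.eval_target hp (u := ⟨j, h₂⟩) hv
  · omega
  · omega
  · rw [Expr.eval]

theorem eval_rejected_of_eq_zero (hs : s.reg 9 = 0) : (Program.rejected b).eval L s = 0 := by
  rw [Program.rejected, Expr.eval, if_neg (by simp [Expr.eval, hs]), Expr.eval]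

theorem eval_rejected_ne_zero_iff (h : Layout I b L M s) {p : Fin n → ℕ} (hp : HoldsCounts L p s)
    {u : Fin n} {w : Fin m} (hu : s.reg 8 = u) (hw : s.reg 9 = w + 1)
    (ht : I.target p u = some w) :
    (Program.rejected b).eval L s ≠ 0 ↔ (I.raise fun _ => s.reg 4).Rejects p u := by
  have hr := h.eval_rivals hp hu hw ht
  have hle := h.enc.header_lt
  have hcap : s.mem (b + 2 + w) = I.cap w := by
    rw [h.input _ (by omega), h.enc.capacity]
  have hc : (Program.rejected b).eval L s = (I.rivals p u w).card + 1 - (I.cap w + s.reg 4) := by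
    rw [Program.rejected, Expr.eval, if_pos (by simp [Expr.eval, hw])]
    simp only [Expr.eval, hr, hw, Nat.add_sub_cancel, hcap]
  rw [hc]
  constructor
  · intro hne
    exact ⟨w, ht, show I.cap w + s.reg 4 ≤ (I.rivals p u w).card by omega⟩
  · rintro ⟨w', hw', hle'⟩
    obtain rfl : w' = w := Option.some_injective _ (hw'.symm.trans ht)
    have : I.cap w' + s.reg 4 ≤ (I.rivals p u w').card := hle'
    omega

theorem reject (h : Layout I b L M s) {p : Fin n → ℕ} (hp : HoldsCounts L p s) {j : ℕ}
    (hj : s.reg 8 = j) :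
    Layout I b L M ((Program.reject b).run L s) ∧
      HoldsCounts L ((I.raise fun _ => s.reg 4).advance p j) ((Program.reject b).run L s) ∧
      ∀ x ≤ 8, ((Program.reject b).run L s).reg x = s.reg x := by
  have ha := h.eval_applied hp hj
  set ρ := s.setReg 9 (Program.applied.eval L s) with hρ
  have h₉ : Layout I b L M ρ := h.setReg (by omega) _
  have hp₉ : HoldsCounts L p ρ := hp
  have e₀ : ρ.reg 0 = L := h₉.bound
  have e₈ : ρ.reg 8 = j := (State.setReg_reg_of_ne _ _ (by omega)).trans hj
  have e₉ : ρ.reg 9 = Program.applied.eval L s := State.setReg_reg_self _ _ _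
  have e₄ : ρ.reg 4 = s.reg 4 := State.setReg_reg_of_ne _ _ (by omega)
  have hrun : (Program.reject b).run L s = if (Program.rejected b).eval L ρ ≠ 0 then
      ρ.setMem (L + L + j) ((Program.count (.var 8)).eval L ρ + 1) else ρ := by
    simp only [Program.reject, Cmd.run, ← hρ, Expr.eval, e₀, e₈]
  have hrej : (Program.rejected b).eval L ρ ≠ 0 ↔
      ∃ hjn : j < n, (I.raise fun _ => s.reg 4).Rejects p ⟨j, hjn⟩ := by
    rw [ha] at e₉
    by_cases hjn : j < n
    · rw [dif_pos hjn] at e₉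
      cases ht : I.target p ⟨j, hjn⟩ with
      | none =>
        rw [ht] at e₉
        refine iff_of_false (fun hne => hne (eval_rejected_of_eq_zero e₉)) ?_
        rintro ⟨_, w, hw, _⟩
        exact Option.some_ne_none _ (hw.symm.trans ht)
      | some w =>
        rw [ht] at e₉
        rw [h₉.eval_rejected_ne_zero_iff hp₉ (u := ⟨j, hjn⟩) e₈ e₉ ht, e₄]
        exact ⟨fun hr => ⟨hjn, hr⟩, fun ⟨_, hr⟩ => hr⟩
    · rw [dif_neg hjn] at e₉
      exact iff_of_false (fun hne => hne (eval_rejected_of_eq_zero e₉)) fun ⟨hjn', _⟩ => hjn hjn'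
  by_cases hne : (Program.rejected b).eval L ρ ≠ 0
  · obtain ⟨hjn, hr⟩ := hrej.1 hne
    rw [hrun, if_pos hne, h₉.eval_count hp₉ (a := .var 8) (u := ⟨j, hjn⟩) e₈, Market.advance,
      dif_pos hjn, if_pos hr]
    refine ⟨h₉.setMem (by omega) _, fun u => ?_, fun x hx => ?_⟩
    · by_cases hu : u = ⟨j, hjn⟩
      · subst hu
        rw [setMem_mem_self, Function.update_self]
      · have : (u : ℕ) ≠ j := fun heq => hu (Fin.ext heq)
        rw [setMem_mem_of_ne _ _ (by omega), Function.update_of_ne hu]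
        exact hp u
    · rw [State.setMem_reg, hρ, State.setReg_reg_of_ne _ _ (by omega)]
  · have hadv : (I.raise fun _ => s.reg 4).advance p j = p := by
      unfold Market.advance
      split_ifs with h₁ h₂
      · exact absurd (hrej.2 ⟨h₁, h₂⟩) hne
      · rfl
      · rfl
    rw [hrun, if_neg hne, hadv]
    exact ⟨h₉, hp₉, fun x hx => State.setReg_reg_of_ne _ _ (by omega)⟩

theorem deferredAcceptance (h : Layout I b L M s) :
    Layout I b L M ((Program.deferredAcceptance b).run L s) ∧
      HoldsCounts L ((I.raise fun _ => s.reg 4).sweeps L L)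
        ((Program.deferredAcceptance b).run L s) ∧
      ∀ x ≤ 6, ((Program.deferredAcceptance b).run L s).reg x = s.reg x := by
  obtain ⟨h₁, h₂, h₃⟩ := h.reset
  set J := I.raise fun _ => s.reg 4
  refine iter_induction (f := (Cmd.rep 8 (Program.reject b)).run L) (i := 7) (L := L)
    (fun j τ => Layout I b L M τ ∧ HoldsCounts L (J.sweeps L j) τ ∧ ∀ x ≤ 6, τ.reg x = s.reg x)
    ⟨h₁, h₂, fun x hx => h₃ x (by omega)⟩ ?_
  rintro j hj τ ⟨h₄, h₅, h₆⟩
  refine iter_induction (f := (Program.reject b).run L) (i := 8) (L := L) (fun i τ =>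
    Layout I b L M τ ∧ HoldsCounts L (J.sweep (J.sweeps L j) i) τ ∧ ∀ x ≤ 6, τ.reg x = s.reg x)
    ⟨h₄.setReg (by omega) _, h₅, fun x hx => ?_⟩ ?_
  · rw [State.setReg_reg_of_ne _ _ (by omega), h₆ x hx]
  · rintro i hi ρ ⟨h₇, h₈, h₉⟩
    obtain ⟨g₁, g₂, g₃⟩ := (h₇.setReg (x := 8) (by omega) i).reject (h₈.setReg 8 i)
      (State.setReg_reg_self _ _ _)
    refine ⟨g₁, ?_, fun x hx => ?_⟩
    · rwa [State.setReg_reg_of_ne _ _ (by omega), h₉ 4 (by omega)] at g₂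
    · rw [g₃ x (by omega), State.setReg_reg_of_ne _ _ (by omega), h₉ x hx]

/-- With `n < L` additional places everywhere all students are matched, so that `L` rounds of the
loop are enough. -/
theorem uniformIncrement (h : Layout I b L M s) (hs : s.reg 5 = 0) :
    ∃ k p, ((Program.uniformIncrement b).run L s).reg 4 = k ∧
      Layout I b L M ((Program.uniformIncrement b).run L s) ∧
      HoldsCounts L p ((Program.uniformIncrement b).run L s) ∧
      UniformReturns I (fun _ => k) (I.target p) ∧ maxNorm (fun _ : Fin m => k) = k := by
  set P : ℕ → Fin n → ℕ := fun k => (I.raise fun _ => k).sweeps L L with hP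
  have hterm : ∀ k, (I.raise fun _ => k).Terminal (P k) := fun k =>
    Market.terminal_sweeps _ h.enc.students_lt.le h.enc.sum_lt
  have key := iter_induction (f := (Cmd.cond (.sub (.const 1) (.var 5)) <|
      .seq (.assign 4 (.var 6)) <| .seq (Program.deferredAcceptance b) <|
      .cond (.sub (.const 1) Program.unmatched) (.assign 5 (.const 1))).run L)
    (i := 6) (L := L) (s := s) (fun j τ => Layout I b L M τ ∧
      ((τ.reg 5 = 0 ∧ ∀ i < j, ¬ IsPerfect (I.target (P i))) ∨
      (τ.reg 5 = 1 ∧ HoldsCounts L (P (τ.reg 4)) τ ∧ IsPerfect (I.target (P (τ.reg 4))) ∧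
        ∀ i < τ.reg 4, ¬ IsPerfect (I.target (P i)))))
    ⟨h, .inl ⟨hs, fun i hi => absurd hi (Nat.not_lt_zero i)⟩⟩ (by
      rintro j hj τ ⟨h₁, h₂⟩
      have e₅ : (τ.setReg 6 j).reg 5 = τ.reg 5 := State.setReg_reg_of_ne _ _ (by omega)
      have e₆ : (τ.setReg 6 j).reg 6 = j := State.setReg_reg_self _ _ _
      have e₄ : (τ.setReg 6 j).reg 4 = τ.reg 4 := State.setReg_reg_of_ne _ _ (by omega)
      simp only [Cmd.run, Expr.eval, e₅, e₆]
      rcases h₂ with ⟨h₂, h₃⟩ | ⟨h₂, h₃, h₄, h₅⟩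
      · rw [if_pos (by omega)]
        set ρ := (τ.setReg 6 j).setReg 4 j
        have hρ₄ : ρ.reg 4 = j := State.setReg_reg_self _ _ _
        have hρ₅ : ρ.reg 5 = 0 := (State.setReg_reg_of_ne _ _ (by omega)).trans (e₅.trans h₂)
        obtain ⟨g₁, g₂, g₃⟩ := ((h₁.setReg (x := 6) (by omega) j).setReg (x := 4) (by omega)
          j).deferredAcceptance
        rw [hρ₄] at g₂
        set χ := (Program.deferredAcceptance b).run L ρ
        have hun := g₁.eval_unmatched_eq_zero_iff g₂
        have hχ₄ : χ.reg 4 = j := (g₃ 4 (by omega)).trans hρ₄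
        have hχ₅ : χ.reg 5 = 0 := (g₃ 5 (by omega)).trans hρ₅
        by_cases hperf : IsPerfect (I.target (P j))
        · rw [if_pos (by have := hun.2 hperf; omega)]
          refine ⟨g₁.setReg (by omega) _, .inr ⟨State.setReg_reg_self _ _ _, ?_⟩⟩
          rw [State.setReg_reg_of_ne _ _ (by omega), hχ₄]
          exact ⟨g₂, hperf, h₃⟩
        · have hne : Program.unmatched.eval L χ ≠ 0 := fun h₀ => hperf (hun.1 h₀)
          rw [if_neg (by omega)]
          refine ⟨g₁, .inl ⟨hχ₅, fun i hi => ?_⟩⟩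
          rcases Nat.lt_succ_iff_lt_or_eq.1 hi with hi | rfl
          · exact h₃ i hi
          · exact hperf
      · rw [if_neg (by omega)]
        refine ⟨h₁.setReg (by omega) _, .inr ⟨e₅.trans h₂, ?_⟩⟩
        rw [e₄]
        exact ⟨h₃, h₄, h₅⟩)
  obtain ⟨h₁, h₂⟩ := key
  rcases h₂ with ⟨-, h₂⟩ | ⟨-, h₂, h₃, h₄⟩
  · exact absurd ((hterm n).isStable.isPerfect_of_le fun _ => le_rfl) (h₂ n h.enc.students_lt)
  · have hk : ∀ j < ((Program.uniformIncrement b).run L s).reg 4, ∃ σ,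
        (I.raise fun _ => j).IsStudentOptimal σ ∧ ¬ IsPerfect σ :=
      fun j hj => ⟨_, (hterm j).isStudentOptimal, h₄ j hj⟩
    exact ⟨_, _, rfl, h₁, h₂, ⟨uniformLoop_of_not_isPerfect (hterm _).isStudentOptimal hk, h₃⟩,
      maxNorm_const hk⟩

/-- The loops write further cells behind the output, up to `L` values each; the copies of the
outcomes start at `L + L + L`, which is out of reach. -/
theorem writeSolution (h : Layout I b L M s) {p : Fin n → ℕ} (hp : HoldsCounts L p s) {k : ℕ}
    (hk : s.reg 4 = k) (hmax : maxNorm (fun _ : Fin m => k) = k) :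
    (Program.writeSolution.run L s).Holds (encodeSolution (fun _ : Fin m => k) (I.target p)) := by
  have hnL := h.enc.students_lt
  have hmL := h.enc.header_lt
  -- the outcomes are computed
  have key₁ := iter_induction (f := (Cmd.store (.add (.add (.add (.var 0) (.var 0)) (.var 0))
    (.var 8)) (Program.target (.var 8))).run L) (i := 8) (L := L) (s := s)
    (fun j τ => Layout I b L M τ ∧ HoldsCounts L p τ ∧ τ.reg 4 = k ∧
      ∀ u : Fin n, (u : ℕ) < j → τ.mem (L + L + L + u) = encodeOutcome (I.target p u))
    ⟨h, hp, hk, fun i hi => absurd hi (Nat.not_lt_zero i)⟩ (by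
      rintro j hj τ ⟨h₁, h₂, h₃, h₄⟩
      have h₁' := h₁.setReg (x := 8) (by omega) j
      have e₈ : (τ.setReg 8 j).reg 8 = j := State.setReg_reg_self _ _ _
      simp only [Cmd.run]
      have hadr : (Expr.add (.add (.add (.var 0) (.var 0)) (.var 0)) (.var 8)).eval L
        (τ.setReg 8 j) = L + L + L + j := by simp only [Expr.eval, h₁'.bound, e₈]
      rw [hadr]
      refine ⟨h₁'.setMem (by omega) _, fun u => ?_,
        (State.setReg_reg_of_ne τ j (show 4 ≠ 8 by omega)).trans h₃, fun u hu => ?_⟩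
      · rw [setMem_mem_of_ne _ _ (by omega)]
        exact h₂ u
      · by_cases huj : (u : ℕ) = j
        · rw [huj, setMem_mem_self]
          exact h₁'.eval_target h₂ (e₈.trans huj.symm)
        · rw [setMem_mem_of_ne _ _ (by omega)]
          exact h₄ u (by omega))
  set s₁ := iter ((Cmd.store (.add (.add (.add (.var 0) (.var 0)) (.var 0))
    (.var 8)) (Program.target (.var 8))).run L) 8 s L
  obtain ⟨h₁, -, hk₁, ho₁⟩ := key₁
  set s₂ := s₁.setMem 0 k with hs₂
  -- the capacity increases are written
  have key₂ := iter_induction (f := (Cmd.store (.add (.const 1) (.var 8)) (.var 4)).run L)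
    (i := 8) (L := L) (s := s₂)
    (fun j τ => (∀ x ≤ 4, τ.reg x = s₁.reg x) ∧ τ.mem 0 = k ∧ (∀ i < j, τ.mem (1 + i) = k) ∧
      ∀ i, τ.mem (L + L + L + i) = s₁.mem (L + L + L + i))
    ⟨fun _ _ => rfl, setMem_mem_self _ _ _, fun i hi => absurd hi (Nat.not_lt_zero i),
      fun i => setMem_mem_of_ne _ _ (by omega)⟩ (by
      rintro j hj τ ⟨h₃, h₄, h₅, h₆⟩
      have e₄ : (τ.setReg 8 j).reg 4 = k :=
        (State.setReg_reg_of_ne _ _ (by omega)).trans ((h₃ 4 le_rfl).trans hk₁)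
      have e₈ : (τ.setReg 8 j).reg 8 = j := State.setReg_reg_self _ _ _
      simp only [Cmd.run, Expr.eval, e₄, e₈]
      refine ⟨fun x hx => ?_, ?_, fun i hi => ?_, fun i => ?_⟩
      · rw [State.setMem_reg, State.setReg_reg_of_ne _ _ (by omega), h₃ x hx]
      · rw [setMem_mem_of_ne _ _ (by omega), setReg_mem, h₄]
      · by_cases hij : i = j
        · rw [hij, setMem_mem_self]
        · rw [setMem_mem_of_ne _ _ (by omega), setReg_mem, h₅ i (by omega)]
      · rw [setMem_mem_of_ne _ _ (by omega), setReg_mem, h₆ i])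
  set s₃ := iter ((Cmd.store (.add (.const 1) (.var 8)) (.var 4)).run L) 8 s₂ L
  obtain ⟨r₃, k₃, c₃, o₃⟩ := key₂
  -- the outcomes are copied
  have key₃ := iter_induction (f := (Cmd.store (.add (.add (.const 1) (.var 2)) (.var 8))
    (.mem (.add (.add (.add (.var 0) (.var 0)) (.var 0)) (.var 8)))).run L)
    (i := 8) (L := L) (s := s₃)
    (fun j τ => (∀ x ≤ 4, τ.reg x = s₁.reg x) ∧ τ.mem 0 = k ∧ (∀ i < m, τ.mem (1 + i) = k) ∧
      (∀ i < j, τ.mem (1 + m + i) = s₁.mem (L + L + L + i)) ∧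
      ∀ i, τ.mem (L + L + L + i) = s₁.mem (L + L + L + i))
    ⟨r₃, k₃, fun i hi => c₃ i (by omega), fun i hi => absurd hi (Nat.not_lt_zero i), o₃⟩ (by
      rintro j hj τ ⟨h₃, h₄, h₅, h₆, h₇⟩
      have e₀ : (τ.setReg 8 j).reg 0 = L :=
        (State.setReg_reg_of_ne _ _ (by omega)).trans ((h₃ 0 (by omega)).trans h₁.bound)
      have e₂ : (τ.setReg 8 j).reg 2 = m :=
        (State.setReg_reg_of_ne _ _ (by omega)).trans ((h₃ 2 (by omega)).trans h₁.schools)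
      have e₈ : (τ.setReg 8 j).reg 8 = j := State.setReg_reg_self _ _ _
      simp only [Cmd.run, Expr.eval, e₀, e₂, e₈, setReg_mem, h₇]
      refine ⟨fun x hx => ?_, ?_, fun i hi => ?_, fun i hi => ?_, fun i => ?_⟩
      · rw [State.setMem_reg, State.setReg_reg_of_ne _ _ (by omega), h₃ x hx]
      · rw [setMem_mem_of_ne _ _ (by omega), setReg_mem, h₄]
      · rw [setMem_mem_of_ne _ _ (by omega), setReg_mem, h₅ i hi]
      · by_cases hij : i = j
        · rw [hij, setMem_mem_self]
        · rw [setMem_mem_of_ne _ _ (by omega), setReg_mem, h₆ i (by omega)]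
      · rw [setMem_mem_of_ne _ _ (by omega), setReg_mem, h₇ i])
  set s₄ := iter ((Cmd.store (.add (.add (.const 1) (.var 2)) (.var 8))
    (.mem (.add (.add (.add (.var 0) (.var 0)) (.var 0)) (.var 8)))).run L) 8 s₃ L
  obtain ⟨r₄, k₄, c₄, o₄, -⟩ := key₃
  have hrun : Program.writeSolution.run L s = s₄.setReg 0 (1 + m + n) := by
    have e₁ := (r₄ 1 (by omega)).trans h₁.students
    have e₂ := (r₄ 2 (by omega)).trans h₁.schools
    rw [← e₁, ← e₂]
    simp only [Program.writeSolution, Cmd.run, Expr.eval]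
    simp only [s₄, s₃, hs₂, ← hk₁]
    rfl
  rw [hrun]
  refine ⟨?_, fun i hi => ?_⟩
  · simp [State.setReg, encodeSolution]
    omega
  · rw [setReg_mem]
    simp only [encodeSolution, List.length_cons, List.length_append, List.length_ofFn] at hi ⊢
    obtain _ | i := i
    · rw [k₄, List.getElem_cons_zero, hmax]
    · rw [List.getElem_cons_succ, show s₄.mem (i + 1) = s₄.mem (1 + i) from
        congrArg _ (add_comm _ _)]
      by_cases him : i < m
      · rw [c₄ i him, List.getElem_append_left (by simpa using him), List.getElem_ofFn]
      · have ho := o₄ (i - m) (by omega)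
        have ho' := ho₁ ⟨i - m, by omega⟩ (by dsimp only; omega)
        rw [show 1 + i = 1 + m + (i - m) by omega, ho, List.getElem_append_right (by simpa using him),
          List.getElem_ofFn]
        simpa using ho'

end Layout

theorem holds_writeDecision {L k k₀ : ℕ} {s : State} (hk : s.reg 4 = k) (h₀ : s.mem 0 = k₀) :
    (Program.writeDecision.run L s).Holds [if k ≤ k₀ then 1 else 0] := by
  refine ⟨State.setReg_reg_self _ _ _, fun i hi => ?_⟩
  obtain rfl : i = 0 := by simpa using hi
  simp only [Program.writeDecision, Cmd.run, Expr.eval, setReg_mem, setMem_mem_self, hk, h₀,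
    List.getElem_cons_zero]
  split_ifs <;> omega

end ManyToOne

theorem mainTheorem8 :
    RAM.DecidableInPolyTime ManyToOne.encodeQuery
      (fun x : ManyToOne.Instance × ℕ => x.1.market.MinMaxSP x.2) ∧
    (∀ (n m : ℕ) (I : ManyToOne.Market n m),
      (∃ r μ, ManyToOne.UniformReturns I r μ) ∧
      ∀ r μ, ManyToOne.UniformReturns I r μ → I.IsBestSolution r μ) ∧
    RAM.SolvableInPolyTime ManyToOne.Instance.encode
      (fun (I : ManyToOne.Instance) (y : List ℕ) =>
        ∃ (r : Fin I.m → ℕ) (μ : ManyToOne.Assignment I.n I.m),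
          y = ManyToOne.encodeSolution r μ ∧
          ManyToOne.UniformReturns I.market r μ ∧ I.market.IsBestSolution r μ) := by
  refine ⟨RAM.solvableInPolyTime_of_cmd ManyToOne.Program.decideMinMaxSP _ _ fun x => ?_,
    fun n m I => ⟨ManyToOne.exists_uniformReturns I, fun r μ h => h.isBestSolution⟩,
    RAM.solvableInPolyTime_of_cmd ManyToOne.Program.solve _ _ fun I => ?_⟩
  · obtain ⟨I, k₀⟩ := x
    have henc := I.encodedIn [k₀]
    obtain ⟨h₁, h₂⟩ := ManyToOne.layout_setup (s := RAM.State.initial (k₀ :: I.encode))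
      (L := (k₀ :: I.encode).length) henc rfl
    obtain ⟨k, p, hk, h₃, -, hret, hmax⟩ := h₁.uniformIncrement (h₂.trans rfl)
    have hiff := hret.minMaxSP_iff k₀
    rw [hmax] at hiff
    refine ⟨[if k ≤ k₀ then 1 else 0], ManyToOne.holds_writeDecision hk (h₃.input 0 (by simp)), ?_⟩
    by_cases hle : k ≤ k₀
    · exact .inl ⟨hiff.2 hle, by rw [if_pos hle]⟩
    · exact .inr ⟨fun hP => hle (hiff.1 hP), by rw [if_neg hle]⟩
  · have henc := I.encodedIn []
    obtain ⟨h₁, h₂⟩ := ManyToOne.layout_setup (s := RAM.State.initial I.encode)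
      (L := I.encode.length) henc rfl
    obtain ⟨k, p, hk, h₃, hp, hret, hmax⟩ := h₁.uniformIncrement (h₂.trans rfl)
    exact ⟨_, h₃.writeSolution hp hk hmax, _, _, rfl, hret, hret.isBestSolution⟩
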